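/- **Setting.** Let $\mathcal M=(\mathcal S,\mathcal A,P,r)$ be a Markov decision process with finite nonempty state and action sets, transition probabilities $p(s'\mid s,a)$ and rewards $r:\mathcal S\times\mathcal A\to[0,1]$. For a stationary deterministic policy $\pi:\mathcal S\to\mathcal A$ let $\mathbb P^\pi,\mathbb E^\pi$ refer to the controlled chain with $a_t=\pi(s_t)$. Assume *reachability*: there is a state $s^\dagger$ such that for every $s$ and every stationary deterministic $\pi$ there is $t\ge 0$ with $\mathbb P^\pi[s_t=s^\dagger\mid s_0=s]>0$. Put $$K:=\max_{\pi,s}\mathbb E^\pi\bigl[\inf\{t>0: s_t=s^\dagger\}\mid s_0=s\bigr].$$ Then $K<\infty$. For every $\pi$ the average reward $g^\pi=\lim_{n\to\infty}\frac1n\mathbb E^\pi[\sum_{t<n}r(s_t,a_t)\mid s_0=s]$ exists and does not depend on $s$; let $g^*=\max_\pi g^\pi$. The Bellman equation $$r(s,a)+\sum_{s'}p(s'\mid s,a)\max_{a'}Q^*(s',a')-g^*=Q^*(s,a)\qquad\text{for all }(s,a)$$ has a solution; let $Q^*$ be any solution. Let $sp(x)=\max_i x_i-\min_i x_i$. **Algorithm.**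 Start with $Q_0=0$. For $t=1,\dots,T$ draw, independently over all $t$ and $(s,a)$, one sample $y_t(s,a)$ and set $Q_t=(1-\lambda)Q_{t-1}+\lambda\widehat{\mathcal T}_t(Q_{t-1})$, where either * (explicit lazy sampling) $y_t(s,a)$ equals $s$ with probability $\frac12$ and is drawn from $p(\cdot\mid s,a)$ with probability $\frac12$, and $\widehat{\mathcal T}_t(Q)(s,a)=r(s,a)+\max_{a'}Q(y_t(s,a),a')$; or * (implicit lazy sampling) $y_t(s,a)\sim p(\cdot\mid s,a)$, and $\widehat{\mathcal T}_t(Q)(s,a)=r(s,a)+\frac12\bigl(\max_{a'}Q(s,a')+\max_{a'}Q(y_t(s,a),a')\bigr)$. Let $Q_T^{\mathrm{corr}}(s,a)=Q_T(s,a)-\frac12\max_{a'}Q_T(s,a')$ and let $\pi_T$ be greedy for $Q_T^{\mathrm{corr}}$, that is $\pi_T(s)\in\arg\max_a Q_T^{\mathrm{corr}}(s,a)$, with ties broken arbitrarily. Use the stepsize $\lambda=\min\{1,K(K+1)2^K\ln T/T\}$. **Theorem.** There are universal constants $C_0,C_1>0$ such that for every such $\mathcal M$ and $s^\dagger$ the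 following hold. 1. For both variants and all $\varepsilon,\xi>0$: if $T\ge 2$ is an integer with $$T\ \ge\ C_0\,\frac{2^{6K}\log^3T}{\varepsilon^2}\,\log\!\Bigl(\frac{|\mathcal S||\mathcal A|T}{\xi}\Bigr),$$ then with probability at least $1-\xi$ the bounds $sp(Q_T^{\mathrm{corr}}-Q^*)\le\varepsilon$ and $g^*-g^{\pi_T}\le\varepsilon$ hold simultaneously. 2. The total sample complexity is $\widetilde O(|\mathcal S||\mathcal A|\varepsilon^{-2})$, up to factors depending on $K$ and logarithmic terms: for all $\varepsilon,\xi\in(0,1]$ there is an integer $T\ge2$ that satisfies the condition in 1 and for which the total number $|\mathcal S||\mathcal A|T$ of samples drawn is at most $$C_1\,2^{6K}\,\frac{|\mathcal S||\mathcal A|}{\varepsilon^2}\Bigl(K+\log\frac{|\mathcal S||\mathcal A|}{\varepsilon\xi}\Bigr)^4 .$$ -/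

import Mathlib

open MeasureTheory ProbabilityTheory Filter Topology
open scoped ENNReal

universe u v w

/-- A finite average-reward Markov decision process with state space `S`, action space `A`,
transition probabilities `p s a s' = p(s' | s, a)` and rewards `r s a ∈ [0, 1]`. -/
structure AMDP (S : Type u) (A : Type v) [Fintype S] where
  p : S → A → S → ℝ
  r : S → A → ℝ
  p_nonneg : ∀ s a s', 0 ≤ p s a s'
  p_sum : ∀ s a, ∑ s', p s a s' = 1
  r_nonneg : ∀ s a, 0 ≤ r s a
  r_le_one : ∀ s a, r s a ≤ 1

namespace AMDP

/-! ### The controlled Markov chain of a stationary deterministic policy -/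

section Chain

variable {S : Type u} {A : Type v} [Fintype S] [MeasurableSpace S] [MeasurableSingletonClass S]

/-- The probability distribution `p(· | s, a)`, as a measure on `S`. -/
noncomputable def transitionMeasure (M : AMDP S A) (s : S) (a : A) : Measure S :=
  ∑ s', ENNReal.ofReal (M.p s a s') • Measure.dirac s'

instance (M : AMDP S A) (s : S) (a : A) : IsProbabilityMeasure (M.transitionMeasure s a) := by
  constructor
  simp only [transitionMeasure, Measure.coe_finsetSum, Finset.sum_apply, Measure.smul_apply,
    measure_univ, smul_eq_mul, mul_one]
  rw [← ENNReal.ofReal_sum_of_nonneg (fun s' _ => M.p_nonneg s a s'), M.p_sum s a,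
    ENNReal.ofReal_one]

/-- The one-step kernel `s ↦ p(· | s, π(s))` of the stationary deterministic policy `π`. -/
noncomputable def stepKernel (M : AMDP S A) (π : S → A) : Kernel S S where
  toFun s := M.transitionMeasure s (π s)
  measurable' := measurable_of_countable _

instance (M : AMDP S A) (π : S → A) : IsMarkovKernel (M.stepKernel π) :=
  ⟨fun s => inferInstanceAs (IsProbabilityMeasure (M.transitionMeasure s (π s)))⟩

/-- The law of `s_{n+1}` given the history `(s_0, …, s_n)` under the policy `π`. -/
noncomputable def historyKernel (M : AMDP S A) (π : S → A) (n : ℕ) :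
    Kernel ((i : Finset.Iic n) → (fun _ : ℕ => S) i) S :=
  (M.stepKernel π).comap (fun h => h ⟨n, Finset.mem_Iic.2 le_rfl⟩) (measurable_pi_apply _)

instance (M : AMDP S A) (π : S → A) (n : ℕ) : IsMarkovKernel (M.historyKernel π n) :=
  inferInstanceAs (IsMarkovKernel ((M.stepKernel π).comap _ _))

/-- `ℙ^π[ · | s_0 = s]`: the law of the state trajectory `(s_0, s_1, …)` started at `s`, when the
action at every time `t` is `a_t = π(s_t)`. -/
noncomputable def pathMeasure (M : AMDP S A) (π : S → A) (s : S) : Measure (ℕ → S) :=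
  Kernel.traj (X := fun _ => S) (M.historyKernel π) 0 (fun _ => s)

/-- Reachability of the reference state `sd`: under every stationary deterministic policy and from
every initial state, `sd` is visited at some time with positive probability. -/
def Reachable (M : AMDP S A) (sd : S) : Prop :=
  ∀ (π : S → A) (s : S), ∃ t : ℕ, 0 < M.pathMeasure π s {x | x t = sd}

/-- The first time `t > 0` at which the trajectory `x` is in `sd` (`∞` if there is none). -/
noncomputable def hitTime (sd : S) (x : ℕ → S) : ℝ≥0∞ :=
  ⨅ (t : ℕ) (_ : 0 < t ∧ x t = sd), (t : ℝ≥0∞)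

/-- The largest expected hitting time
`max_{π, s} 𝔼^π[inf {t > 0 | s_t = sd} | s_0 = s]`, in `[0, ∞]`. -/
noncomputable def maxHitTime (M : AMDP S A) (sd : S) : ℝ≥0∞ :=
  ⨆ (π : S → A) (s : S), ∫⁻ x, hitTime sd x ∂(M.pathMeasure π s)

/-- The same quantity as a real number; this is the constant `K`. -/
noncomputable def hitConst (M : AMDP S A) (sd : S) : ℝ := (M.maxHitTime sd).toReal

/-- `(1 / n) 𝔼^π[∑_{t < n} r(s_t, a_t) | s_0 = s]`. -/
noncomputable def averageReward (M : AMDP S A) (π : S → A) (s : S) (n : ℕ) : ℝ :=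
  (1 / (n : ℝ)) * ∫ x, ∑ t ∈ Finset.range n, M.r (x t) (π (x t)) ∂(M.pathMeasure π s)

/-- The long-run average reward of `π` exists and equals `g` from every initial state. -/
def HasGain (M : AMDP S A) (π : S → A) (g : ℝ) : Prop :=
  ∀ s, Tendsto (M.averageReward π s) atTop (𝓝 g)

end Chain

/-! ### Bellman operator and span seminorm -/

section Bellman

variable {S : Type u} {A : Type v} [Fintype S] [Fintype A] [Nonempty A]

/-- The greedy value `max_a Q(s, a)`. -/
noncomputable def maxQ (Q : S → A → ℝ) (s : S) : ℝ :=
  Finset.univ.sup' Finset.univ_nonempty (Q s)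

/-- The Bellman operator of the kernel `P`. -/
noncomputable def bellman (M : AMDP S A) (Q : S → A → ℝ) (s : S) (a : A) : ℝ :=
  M.r s a + ∑ s', M.p s a s' * maxQ Q s'

/-- `Q` is an optimal Q-function: it solves the average-reward Bellman equation
`𝒯_P(Q) - g* 𝟏 = Q`, where `gStar` is the optimal average reward. -/
def IsOptimalQ (M : AMDP S A) (gStar : ℝ) (Q : S → A → ℝ) : Prop :=
  ∀ s a, M.bellman Q s a - gStar = Q s a

/-- The stationary deterministic policy `π` is greedy for `Q`. -/
def IsGreedy (Q : S → A → ℝ) (π : S → A) : Prop := ∀ s a, Q s a ≤ Q s (π s)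

/-- The span `max - min` of a vector indexed by state-action pairs. -/
noncomputable def span [Nonempty S] (Q : S → A → ℝ) : ℝ :=
  Finset.univ.sup' Finset.univ_nonempty (fun z : S × A => Q z.1 z.2) -
    Finset.univ.inf' Finset.univ_nonempty (fun z : S × A => Q z.1 z.2)

end Bellman

/-! ### Synchronous lazy Q-learning -/

/-- The two sampling variants of the algorithm. -/
inductive Variant
  | explicitLazy
  | implicitLazy

section Algorithm

variable {S : Type u} {A : Type v} [Fintype S] [DecidableEq S] [Fintype A] [Nonempty A]

/-- The lazy transition kernel with parameter `1 / 2`: stay with probability `1 / 2`, otherwise move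
according to `p(· | s, a)`. -/
noncomputable def lazyP (M : AMDP S A) (s : S) (a : A) (s' : S) : ℝ :=
  if s' = s then 1 / 2 + 1 / 2 * M.p s a s else 1 / 2 * M.p s a s'

/-- The law of the sample drawn for the pair `(s, a)`. -/
noncomputable def sampleLaw (M : AMDP S A) : Variant → S → A → S → ℝ
  | .explicitLazy => M.lazyP
  | .implicitLazy => M.p

/-- The empirical Bellman operator built from one sample `y s a` for every pair `(s, a)`. -/
noncomputable def empBellman (M : AMDP S A) (η : Variant) (y : S → A → S) (Q : S → A → ℝ)
    (s : S) (a : A) : ℝ :=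
  match η with
  | .explicitLazy => M.r s a + maxQ Q (y s a)
  | .implicitLazy => M.r s a + 1 / 2 * (maxQ Q s + maxQ Q (y s a))

/-- The iterates `Q_t`, from `Q_0 = 0`; `y t s a` is the sample for `(s, a)` in iteration `t ≥ 1`. -/
noncomputable def iterate (M : AMDP S A) (η : Variant) (lam : ℝ) (y : ℕ → S → A → S) :
    ℕ → S → A → ℝ
  | 0 => fun _ _ => 0
  | t + 1 => fun s a =>
      (1 - lam) * iterate M η lam y t s a
        + lam * M.empBellman η (y (t + 1)) (iterate M η lam y t) s a

/-- The output correction. -/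
noncomputable def corrected (Q : S → A → ℝ) (s : S) (a : A) : ℝ := Q s a - 1 / 2 * maxQ Q s

/-- The constant stepsize `min {1, K (K + 1) 2^K ln T / T}`. -/
noncomputable def stepsize (K : ℝ) (T : ℕ) : ℝ :=
  min 1 (K * (K + 1) * (2 : ℝ) ^ K * Real.log T / T)

/-- The random variables `X t s a`, `1 ≤ t ≤ T`, are the samples drawn by a run of `T` iterations:
they are independent, and `X t s a` has the law that the variant `η` prescribes for `(s, a)`. -/
structure IsSampling {Ω : Type w} [MeasurableSpace Ω] [MeasurableSpace S]
    (M : AMDP S A) (η : Variant) (T : ℕ) (X : ℕ → S → A → Ω → S) (μ : Measure Ω) : Prop where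
  measurable : ∀ t ∈ Finset.Icc 1 T, ∀ s a, Measurable (X t s a)
  indep : iIndepFun (fun i : Finset.Icc 1 T × S × A => X i.1 i.2.1 i.2.2) μ
  law : ∀ t ∈ Finset.Icc 1 T, ∀ s a s',
    μ.real {ω | X t s a ω = s'} = M.sampleLaw η s a s'

/-- The number of samples drawn in `T` iterations: one for every iteration and every pair. -/
def numSamples (S : Type u) (A : Type v) [Fintype S] [Fintype A] (T : ℕ) : ℕ :=
  (Finset.Icc 1 T ×ˢ (Finset.univ : Finset (S × A))).card

/-- The requirement
`T ≥ C₀ · 2^{6K} log³ T / ε² · log(|S| |A| T / ξ)` on the number of iterations. -/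
def EnoughIterations (S : Type u) (A : Type v) [Fintype S] [Fintype A]
    (C₀ K ε ξ : ℝ) (T : ℕ) : Prop :=
  C₀ * ((2 : ℝ) ^ (6 * K) * Real.log T ^ 3 / ε ^ 2) *
    Real.log (Fintype.card S * Fintype.card A * T / ξ) ≤ T

end Algorithm

end AMDP

/-!
# Lazy Q-learning for average-reward decision processes

Write `V = max_a Q` and let `κ = K (K + 1) 2 ^ K`. Both sampling variants give unbiased estimates of
the lazy Bellman operator `r + (I + P) V / 2`. Its fixed points modulo constants correspond, under
`Q ↦ Q - V / 2`, to the solutions of the original Bellman equation with the same gain, so it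
suffices to follow the distance of the iterates to a fixed point of the lazy operator.

*Contraction.* Reachability makes the expected hitting times of `sd` finite, and the slowest
stationary policy (found by policy improvement) provides `W : S → [1, K]` with
`1 + ∑_{s' ≠ sd} p(s' | s, a) W(s') ≤ W(s)` for *all* actions (`exists_lyapunov`). Along every sequence of policies, `sd`
is therefore hit within `n` moves with probability at least `1 - K / (n + 1)`. A lazy chain can make
these moves without a pause and then wait at `sd`, so it sits at `sd` at time `n` with probability
at least `2⁻ⁿ (1 - K / (n + 1))`. Hence `n` lazy steps under common policies shrink the span by the
complementary factor (`multiStep_le`). With `n` equal to `⌊K⌋` or `⌊K⌋ + 1`, the weighted maximum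
over `k < n` of the largest span after `k` steps is a seminorm that is equivalent to the span and in
which the lazy operator contracts in *one* step, with modulus `1 - 1 / (2 κ)`
(`exists_contracting_seminorm`). Iterating the contraction solves the Bellman equation. Applied to a
process with a single policy it solves the Poisson equation, which yields the average rewards; the
maximum principle compares them with the optimal gain (`gain_le`, `gain_gap_le`).

*Noise.* Subtract from the iterates the exponentially weighted average of the sampling errors. What
is left obeys a recursion with contraction factor `1 - λ / (2 κ)`, driven by the size of that
average (`seminorm_error_le`). Because `0 ≤ Q_t ≤ λ t ≤ κ log T`, each sampling error ranges over an
interval of length at most `κ log T`, and Hoeffding's lemma with the independence of the samples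
makes the average sub-Gaussian with variance proxy of order `λ (κ log T)²`
(`hasSubgaussianMGF_noise`). A union bound over the run and `κ⁵ ≤ C 2 ^ (6 K)` then give the stated
condition on `T`.
-/

namespace AMDP

/-! ### The span seminorm and the lazy Bellman operator -/

section MaxQ

variable {S : Type u} {A : Type v} [Fintype A] [Nonempty A]

lemma le_maxQ (Q : S → A → ℝ) (s : S) (a : A) : Q s a ≤ maxQ Q s :=
  Finset.le_sup' (Q s) (Finset.mem_univ a)

lemma maxQ_le {Q : S → A → ℝ} {s : S} {c : ℝ} (h : ∀ a, Q s a ≤ c) : maxQ Q s ≤ c :=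
  Finset.sup'_le _ _ fun a _ => h a

lemma exists_eq_maxQ (Q : S → A → ℝ) (s : S) : ∃ a, Q s a = maxQ Q s := by
  obtain ⟨a, -, ha⟩ := Finset.exists_mem_eq_sup' Finset.univ_nonempty (Q s)
  exact ⟨a, ha.symm⟩

lemma maxQ_sub_mem_Icc {Q Q' : S → A → ℝ} {s : S} {m c : ℝ}
    (h : ∀ a, Q s a - Q' s a ∈ Set.Icc m c) : maxQ Q s - maxQ Q' s ∈ Set.Icc m c := by
  obtain ⟨a, ha⟩ := exists_eq_maxQ Q s
  obtain ⟨b, hb⟩ := exists_eq_maxQ Q' s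
  have h1 := (h a).2
  have h2 := (h b).1
  have h3 := le_maxQ Q s b
  have h4 := le_maxQ Q' s a
  exact ⟨by linarith, by linarith⟩

lemma maxQ_sub_maxQ_mem (Q Q' : S → A → ℝ) (s : S) :
    ∃ a a', maxQ Q s - maxQ Q' s ∈ Set.Icc ((Q - Q') s a) ((Q - Q') s a') := by
  obtain ⟨a, ha⟩ := exists_eq_maxQ Q s
  obtain ⟨b, hb⟩ := exists_eq_maxQ Q' s
  refine ⟨b, a, ?_, ?_⟩ <;> simp only [Pi.sub_apply]
  · linarith [le_maxQ Q s b]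
  · linarith [le_maxQ Q' s a]

lemma continuous_maxQ (s : S) : Continuous fun Q : S → A → ℝ => maxQ Q s := by
  unfold maxQ
  exact Continuous.finset_sup'_apply _ fun a _ => by fun_prop

lemma maxQ_add_const (Q : S → A → ℝ) (f : S → ℝ) (s : S) :
    maxQ (fun s a => Q s a + f s) s = maxQ Q s + f s := by
  refine le_antisymm (maxQ_le fun a => by linarith [le_maxQ Q s a]) ?_
  obtain ⟨a, ha⟩ := exists_eq_maxQ Q s
  rw [← ha]
  exact le_maxQ (fun s a => Q s a + f s) s a

end MaxQ

section Span

variable {S : Type u} {A : Type v} [Fintype S] [Fintype A] [Nonempty A] [Nonempty S]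

lemma sub_le_span (Q : S → A → ℝ) (s s' : S) (a a' : A) : Q s a - Q s' a' ≤ span Q :=
  sub_le_sub (Finset.le_sup' (fun z : S × A => Q z.1 z.2) (Finset.mem_univ (s, a)))
    (Finset.inf'_le (fun z : S × A => Q z.1 z.2) (Finset.mem_univ (s', a')))

lemma span_eq_sub (Q : S → A → ℝ) : ∃ s a s' a', span Q = Q s a - Q s' a' := by
  obtain ⟨z, -, hz⟩ := Finset.exists_mem_eq_sup' (Finset.univ_nonempty (α := S × A))
    (fun z : S × A => Q z.1 z.2)
  obtain ⟨z', -, hz'⟩ := Finset.exists_mem_eq_inf' (Finset.univ_nonempty (α := S × A))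
    (fun z : S × A => Q z.1 z.2)
  exact ⟨z.1, z.2, z'.1, z'.2, by rw [span, hz, hz']⟩

lemma span_le_iff {Q : S → A → ℝ} {c : ℝ} :
    span Q ≤ c ↔ ∀ s a s' a', Q s a - Q s' a' ≤ c := by
  refine ⟨fun h s a s' a' => (sub_le_span Q s s' a a').trans h, fun h => ?_⟩
  obtain ⟨s, a, s', a', hQ⟩ := span_eq_sub Q
  exact hQ ▸ h s a s' a'

lemma span_le_of_mem_Icc {Q : S → A → ℝ} {m c : ℝ} (h : ∀ s a, Q s a ∈ Set.Icc m c) :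
    span Q ≤ c - m :=
  span_le_iff.2 fun s a s' a' => sub_le_sub (h s a).2 (h s' a').1

lemma exists_mem_Icc_span (Q : S → A → ℝ) : ∃ m, ∀ s a, Q s a ∈ Set.Icc m (m + span Q) := by
  obtain ⟨s₁, a₁, s₀, a₀, h⟩ := span_eq_sub Q
  refine ⟨Q s₀ a₀, fun s a => ⟨?_, ?_⟩⟩
  · have := sub_le_span Q s₁ s a₁ a
    linarith
  · have := sub_le_span Q s s₀ a a₀
    linarith

variable (S A) in
/-- The span as a seminorm on the functions of state-action pairs. -/
noncomputable def spanSeminorm : Seminorm ℝ (S → A → ℝ) :=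
  Seminorm.ofSMulLE span
    (by
      refine le_antisymm (span_le_iff.2 fun s a s' a' => by simp) ?_
      have := sub_le_span (0 : S → A → ℝ) (Classical.arbitrary S) (Classical.arbitrary S)
        (Classical.arbitrary A) (Classical.arbitrary A)
      simpa using this)
    (fun x y => span_le_iff.2 fun s a s' a' => by
      have h1 := sub_le_span x s s' a a'
      have h2 := sub_le_span y s s' a a'
      simp only [Pi.add_apply]
      linarith)
    (fun c x => span_le_iff.2 fun s a s' a' => by
      simp only [Pi.smul_apply, smul_eq_mul, Real.norm_eq_abs]
      rw [← mul_sub]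
      refine (le_abs_self _).trans ?_
      rw [abs_mul]
      refine mul_le_mul_of_nonneg_left (abs_le.2 ⟨?_, sub_le_span x s s' a a'⟩) (abs_nonneg c)
      have := sub_le_span x s' s a' a
      linarith)

@[simp] lemma spanSeminorm_apply (Q : S → A → ℝ) : spanSeminorm S A Q = span Q := rfl

end Span

section LazyStep

variable {S : Type u} {A : Type v} [Fintype S]

lemma sum_p_mul_mem_Icc (M : AMDP S A) {d : S → ℝ} {m c : ℝ} (h : ∀ s, d s ∈ Set.Icc m c)
    (s : S) (a : A) : ∑ s', M.p s a s' * d s' ∈ Set.Icc m c := by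
  constructor
  · calc m = ∑ s', M.p s a s' * m := by rw [← Finset.sum_mul, M.p_sum, one_mul]
      _ ≤ _ := Finset.sum_le_sum fun s' _ =>
        mul_le_mul_of_nonneg_left (h s').1 (M.p_nonneg s a s')
  · calc _ ≤ ∑ s', M.p s a s' * c := Finset.sum_le_sum fun s' _ =>
        mul_le_mul_of_nonneg_left (h s').2 (M.p_nonneg s a s')
      _ = c := by rw [← Finset.sum_mul, M.p_sum, one_mul]

/-- One lazy step applied to a function of the state: stay with probability `1 / 2`, otherwise move
according to `p(· | s, a)`. -/
noncomputable def lazyStep (M : AMDP S A) : (S → ℝ) →ₗ[ℝ] (S → A → ℝ) where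
  toFun d s a := 1 / 2 * d s + 1 / 2 * ∑ s', M.p s a s' * d s'
  map_add' x y := by
    funext s a
    simp only [Pi.add_apply, mul_add, Finset.sum_add_distrib]
    ring
  map_smul' c x := by
    funext s a
    simp only [Pi.smul_apply, smul_eq_mul, RingHom.id_apply, mul_add, Finset.mul_sum]
    congr 1
    · ring
    · exact Finset.sum_congr rfl fun i _ => by ring

lemma lazyStep_apply (M : AMDP S A) (d : S → ℝ) (s : S) (a : A) :
    M.lazyStep d s a = 1 / 2 * d s + 1 / 2 * ∑ s', M.p s a s' * d s' := rfl

lemma lazyStep_mem_Icc (M : AMDP S A) {d : S → ℝ} {m c : ℝ} (h : ∀ s, d s ∈ Set.Icc m c)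
    (s : S) (a : A) : M.lazyStep d s a ∈ Set.Icc m c := by
  have h1 := h s
  have h2 := M.sum_p_mul_mem_Icc h s a
  rw [lazyStep_apply]
  exact ⟨by linarith [h1.1, h2.1], by linarith [h1.2, h2.2]⟩

lemma lazyStep_sub_const (M : AMDP S A) (d : S → ℝ) (m : ℝ) (s : S) (a : A) :
    M.lazyStep (fun s' => d s' - m) s a = M.lazyStep d s a - m := by
  simp only [lazyStep_apply, mul_sub, Finset.sum_sub_distrib]
  rw [← Finset.sum_mul, M.p_sum]
  ring

lemma lazyStep_const_sub (M : AMDP S A) (d : S → ℝ) (m : ℝ) (s : S) (a : A) :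
    M.lazyStep (fun s' => m - d s') s a = m - M.lazyStep d s a := by
  simp only [lazyStep_apply, mul_sub, Finset.sum_sub_distrib]
  rw [← Finset.sum_mul, M.p_sum]
  ring

/-- One lazy step turns a lower bound by a multiple of `2⁻ʲ (1 - W / (j + 1))`, where `W` is read as
`0` at `sd`, into the same bound for `j + 1`. By induction, a lazy chain is at `sd` after `j` steps
with at least this probability. -/
lemma lyapunov_step (M : AMDP S A) {sd : S} {W : S → ℝ} [DecidableEq S]
    (hW : ∀ s a, 1 + ∑ s', M.p s a s' * (if s' = sd then 0 else W s') ≤ W s) {c : ℝ} (hc : 0 ≤ c)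
    {y : S → ℝ} (hy : ∀ s, 0 ≤ y s) {j : ℕ}
    (h : ∀ s, c * (1 / 2) ^ j * (1 - (if s = sd then 0 else W s) / (j + 1)) ≤ y s) (s : S) (a : A) :
    c * (1 / 2) ^ (j + 1) * (1 - (if s = sd then 0 else W s) / ((j + 1 : ℕ) + 1)) ≤
      M.lazyStep y s a := by
  have hj : (0 : ℝ) < j + 1 := by positivity
  have hcj : 0 ≤ c * (1 / 2) ^ (j + 1) := by positivity
  have hsum : 0 ≤ ∑ s', M.p s a s' * y s' :=
    Finset.sum_nonneg fun s' _ => mul_nonneg (M.p_nonneg s a s') (hy s')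
  rw [lazyStep_apply]
  by_cases hs : s = sd
  · have := h s
    simp only [hs, if_true, zero_div, sub_zero, mul_one] at this hsum ⊢
    rw [pow_succ]
    linarith
  · rw [if_neg hs]
    by_cases hWs : W s ≤ j + 2
    · have h1 : c * (1 / 2) ^ j * (1 - (W s - 1) / (j + 1)) ≤ ∑ s', M.p s a s' * y s' := by
        calc c * (1 / 2) ^ j * (1 - (W s - 1) / (j + 1))
            ≤ c * (1 / 2) ^ j *
                (1 - (∑ s', M.p s a s' * (if s' = sd then 0 else W s')) / (j + 1)) := by
              gcongr
              linarith [hW s a]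
          _ = ∑ s', M.p s a s' *
                (c * (1 / 2) ^ j * (1 - (if s' = sd then 0 else W s') / (j + 1))) := by
              have : (1 : ℝ) = ∑ s', M.p s a s' := (M.p_sum s a).symm
              rw [Finset.sum_div]
              nth_rewrite 2 [this]
              rw [← Finset.sum_sub_distrib, Finset.mul_sum]
              exact Finset.sum_congr rfl fun s' _ => by ring
          _ ≤ _ := Finset.sum_le_sum fun s' _ =>
              mul_le_mul_of_nonneg_left (h s') (M.p_nonneg s a s')
      have h2 : 1 - W s / ((j + 1 : ℕ) + 1) ≤ 1 - (W s - 1) / (j + 1) := by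
        push_cast
        have : (W s - 1) / (j + 1) ≤ W s / (j + 1 + 1) := by
          rw [div_le_div_iff₀ hj (by positivity)]
          linarith
        linarith
      have h3 := mul_le_mul_of_nonneg_left h2 hcj
      rw [pow_succ] at h3 ⊢
      have := hy s
      linarith
    · have h2 : 1 - W s / ((j + 1 : ℕ) + 1) ≤ 0 := by
        push_cast
        rw [sub_nonpos, le_div_iff₀ (by positivity)]
        linarith [not_le.1 hWs]
      have := mul_nonpos_of_nonneg_of_nonpos hcj h2
      have := hy s
      linarith

end LazyStep

section LazyBellman

variable {S : Type u} {A : Type v} [Fintype S] [Fintype A] [Nonempty A]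

/-- The lazy Bellman operator `Q ↦ r + (I + P) / 2 · max_a Q`. Both sampling variants of the
algorithm produce unbiased estimates of it. -/
noncomputable def lazyBellman (M : AMDP S A) (Q : S → A → ℝ) (s : S) (a : A) : ℝ :=
  M.r s a + M.lazyStep (maxQ Q) s a

lemma lazyBellman_sub (M : AMDP S A) (Q Q' : S → A → ℝ) :
    M.lazyBellman Q - M.lazyBellman Q' = M.lazyStep (maxQ Q - maxQ Q') := by
  rw [map_sub]
  funext s a
  simp only [lazyBellman, Pi.sub_apply]
  ring

end LazyBellman

/-- The restriction of a function of state-action pairs to the graph of a policy. -/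
def restrictPolicy {S : Type u} {A : Type v} (π : S → A) : (S → A → ℝ) →ₗ[ℝ] (S → ℝ) where
  toFun Q s := Q s (π s)
  map_add' _ _ := rfl
  map_smul' _ _ := rfl

@[simp] lemma restrictPolicy_apply {S : Type u} {A : Type v} (π : S → A) (Q : S → A → ℝ) (s : S) :
    restrictPolicy π Q s = Q s (π s) := rfl

section Seminorms

variable {S : Type u} {A : Type v} [Fintype S] [Fintype A] [Nonempty A] [Nonempty S]

lemma span_lazyStep_le (M : AMDP S A) (π : S → A) (Q : S → A → ℝ) :
    span (M.lazyStep (restrictPolicy π Q)) ≤ span Q := by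
  obtain ⟨m, hm⟩ := exists_mem_Icc_span Q
  have := span_le_of_mem_Icc (M.lazyStep_mem_Icc (d := restrictPolicy π Q) fun s => hm s (π s))
  linarith

open Classical in
/-- The largest span that `k` lazy steps can produce from `Q`, over all nonstationary deterministic
policies. -/
noncomputable def multiStep (M : AMDP S A) : ℕ → Seminorm ℝ (S → A → ℝ)
  | 0 => spanSeminorm S A
  | k + 1 => Finset.univ.sup fun π : S → A =>
      (multiStep M k).comp (M.lazyStep ∘ₗ restrictPolicy π)

lemma multiStep_succ_le (M : AMDP S A) {k : ℕ} {Q : S → A → ℝ} {c : ℝ}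
    (h : ∀ π, M.multiStep k (M.lazyStep (restrictPolicy π Q)) ≤ c) :
    M.multiStep (k + 1) Q ≤ c := by
  rw [multiStep]
  exact Seminorm.finset_sup_apply_le ((apply_nonneg _ _).trans (h fun _ => Classical.arbitrary A))
    fun π _ => h π

lemma le_multiStep_succ (M : AMDP S A) (k : ℕ) (Q : S → A → ℝ) (π : S → A) :
    M.multiStep k (M.lazyStep (restrictPolicy π Q)) ≤ M.multiStep (k + 1) Q := by
  classical
  exact Seminorm.le_finset_sup_apply (p := fun π : S → A =>
    (multiStep M k).comp (M.lazyStep ∘ₗ restrictPolicy π)) (Finset.mem_univ π)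

lemma multiStep_le_span (M : AMDP S A) (k : ℕ) (Q : S → A → ℝ) : M.multiStep k Q ≤ span Q := by
  induction k generalizing Q with
  | zero => exact le_rfl
  | succ k ih => exact M.multiStep_succ_le fun π => (ih _).trans (M.span_lazyStep_le π Q)

/-- A state function that lies between `min_a Q(s, a)` and `max_a Q(s, a)` is a mixture of
restrictions of `Q` to deterministic policies, and seminorms are convex. -/
lemma multiStep_lazyStep_le (M : AMDP S A) (k : ℕ) {Q : S → A → ℝ} {d : S → ℝ}
    (h : ∀ s, ∃ a a', d s ∈ Set.Icc (Q s a) (Q s a')) :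
    M.multiStep k (M.lazyStep d) ≤ M.multiStep (k + 1) Q := by
  have hconv : Convex ℝ {e : S → ℝ | M.multiStep k (M.lazyStep e) ≤ M.multiStep (k + 1) Q} := by
    have := (((M.multiStep k).comp M.lazyStep).convexOn).convex_le (M.multiStep (k + 1) Q)
    simpa using this
  have hsub : Set.univ.pi (fun s => Set.range (Q s)) ⊆
      {e : S → ℝ | M.multiStep k (M.lazyStep e) ≤ M.multiStep (k + 1) Q} := by
    intro e he
    choose π hπ using fun s => he s (Set.mem_univ s)
    have : e = restrictPolicy π Q := funext fun s => (hπ s).symm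
    rw [this]
    exact M.le_multiStep_succ k Q π
  refine convexHull_min hsub hconv ?_
  rw [convexHull_pi]
  intro s _
  obtain ⟨a, a', ha⟩ := h s
  refine segment_subset_convexHull (Set.mem_range_self a) (Set.mem_range_self a') ?_
  rwa [segment_eq_Icc (ha.1.trans ha.2)]

/-- The two-sided form of the propagation in `lyapunov_step`: after `j + k` steps both ends of the
range of `Q` have moved inwards. -/
lemma multiStep_le_of_lyapunov (M : AMDP S A) {sd : S} {W : S → ℝ} [DecidableEq S] {K : ℝ}
    (hWK : ∀ s, W s ≤ K) (hK : 0 ≤ K)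
    (hW : ∀ s a, 1 + ∑ s', M.p s a s' * (if s' = sd then 0 else W s') ≤ W s)
    {m b c c' : ℝ} (hc : 0 ≤ c) (hc' : 0 ≤ c') (k j : ℕ) {Q : S → A → ℝ}
    (hQ : ∀ s a, Q s a ∈ Set.Icc m b)
    (h : ∀ s a, c * (1 / 2) ^ j * (1 - (if s = sd then 0 else W s) / (j + 1)) ≤ Q s a - m)
    (h' : ∀ s a, c' * (1 / 2) ^ j * (1 - (if s = sd then 0 else W s) / (j + 1)) ≤ b - Q s a) :
    M.multiStep k Q ≤
      b - m - (c + c') * ((1 / 2) ^ (j + k) * (1 - K / ((j + k : ℕ) + 1))) := by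
  induction k generalizing j Q with
  | zero =>
    have key : ∀ s, 1 - K / ((j + 0 : ℕ) + 1) ≤
        1 - (if s = sd then 0 else W s) / ((j : ℝ) + 1) := by
      intro s
      push_cast
      rw [add_zero]
      gcongr
      split_ifs
      · exact hK
      · exact hWK s
    refine span_le_iff.2 fun s a s' a' => ?_
    have h1 := mul_le_mul_of_nonneg_left (key s) (by positivity : 0 ≤ c' * (1 / 2) ^ j)
    have h2 := mul_le_mul_of_nonneg_left (key s') (by positivity : 0 ≤ c * (1 / 2) ^ j)
    have h3 := h s' a'
    have h4 := h' s a
    rw [Nat.add_zero] at *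
    linarith
  | succ k ih =>
    refine M.multiStep_succ_le fun π => ?_
    have := ih (j + 1) (Q := M.lazyStep (restrictPolicy π Q))
      (M.lazyStep_mem_Icc fun s => hQ s (π s))
      (fun s a => by
        rw [← M.lazyStep_sub_const]
        exact M.lyapunov_step hW hc (fun s => sub_nonneg.2 (hQ s (π s)).1) (fun s => h s (π s)) s a)
      (fun s a => by
        rw [← M.lazyStep_const_sub]
        exact M.lyapunov_step hW hc' (fun s => sub_nonneg.2 (hQ s (π s)).2)
          (fun s => h' s (π s)) s a)
    rwa [show j + 1 + k = j + (k + 1) by ring] at this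

/-- The span contraction in `n` lazy steps. The two extremes of the span meet at `sd`, where the
last policy selects the same action for both. -/
lemma multiStep_le (M : AMDP S A) {sd : S} {W : S → ℝ} [DecidableEq S] {K : ℝ}
    (hW1 : ∀ s, 1 ≤ W s) (hWK : ∀ s, W s ≤ K)
    (hW : ∀ s a, 1 + ∑ s', M.p s a s' * (if s' = sd then 0 else W s') ≤ W s)
    {n : ℕ} (hn : n ≠ 0) (Q : S → A → ℝ) :
    M.multiStep n Q ≤ (1 - (1 / 2) ^ n * (1 - K / (n + 1))) * span Q := by
  obtain ⟨k, rfl⟩ := Nat.exists_eq_succ_of_ne_zero hn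
  obtain ⟨m, hm⟩ := exists_mem_Icc_span Q
  refine M.multiStep_succ_le fun π => ?_
  have hK : 0 ≤ K := by linarith [hW1 sd, hWK sd]
  have hb : ∀ (c : ℝ) (y : S → ℝ), 0 ≤ c → (∀ s, 0 ≤ y s) → c ≤ y sd → ∀ s,
      c * (1 / 2) ^ 0 * (1 - (if s = sd then 0 else W s) / ((0 : ℕ) + 1)) ≤ y s := by
    intro c y hc hy hcy s
    simp only [pow_zero, mul_one, Nat.cast_zero, zero_add, div_one]
    split_ifs with hs
    · rw [hs]
      linarith
    · nlinarith [hW1 s, hy s]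
  have h1 := (hm sd (π sd)).1
  have h2 := (hm sd (π sd)).2
  have := M.multiStep_le_of_lyapunov (c := Q sd (π sd) - m) (c' := m + span Q - Q sd (π sd))
    (m := m) (b := m + span Q) hWK hK hW
    (sub_nonneg.2 h1) (sub_nonneg.2 h2) k 1 (Q := M.lazyStep (restrictPolicy π Q))
    (M.lazyStep_mem_Icc fun s => hm s (π s))
    (fun s a => by
      rw [← M.lazyStep_sub_const]
      exact M.lyapunov_step hW (sub_nonneg.2 h1) (fun s => sub_nonneg.2 (hm s (π s)).1)
        (hb _ (fun s => Q s (π s) - m) (sub_nonneg.2 h1) (fun s => sub_nonneg.2 (hm s (π s)).1)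
          le_rfl) s a)
    (fun s a => by
      rw [← M.lazyStep_const_sub]
      exact M.lyapunov_step hW (sub_nonneg.2 h2) (fun s => sub_nonneg.2 (hm s (π s)).2)
        (hb _ (fun s => m + span Q - Q s (π s)) (sub_nonneg.2 h2)
          (fun s => sub_nonneg.2 (hm s (π s)).2) le_rfl) s a)
  rw [show 1 + k = k.succ by rw [Nat.succ_eq_add_one, add_comm]] at this
  linarith

/-- A seminorm equivalent to the span in which the lazy Bellman operator contracts in one step: the
weighted maximum of the spans reachable in `k < n` steps. -/
theorem exists_seminorm (M : AMDP S A) {n : ℕ} (hn : n ≠ 0) {δ β : ℝ} (hβ : 0 < β) (hβ1 : β ≤ 1)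
    (hδ : ∀ Q, M.multiStep n Q ≤ (1 - δ) * span Q) (hδ1 : δ ≤ 1 / 2) (hβδ : 1 - δ ≤ β ^ n) :
    ∃ N : Seminorm ℝ (S → A → ℝ), (∀ Q, span Q ≤ N Q) ∧ (∀ Q, N Q ≤ 2 * span Q) ∧
      ∀ Q Q', N (M.lazyBellman Q - M.lazyBellman Q') ≤ β * N (Q - Q') := by
  have hβ' : 0 ≤ β⁻¹ := inv_nonneg.2 hβ.le
  set f : ℕ → Seminorm ℝ (S → A → ℝ) := fun k =>
    Real.toNNReal (β⁻¹ ^ k) • M.multiStep k with hf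
  have hfa : ∀ k Q, f k Q = β⁻¹ ^ k * M.multiStep k Q := fun k Q => by
    rw [hf, smul_apply, NNReal.smul_def, Real.coe_toNNReal _ (pow_nonneg hβ' k), smul_eq_mul]
  have hpos : ∀ Q : S → A → ℝ, 0 ≤ span Q := fun Q => apply_nonneg (spanSeminorm S A) Q
  have hspan : ∀ Q, span Q ≤ ((Finset.range n).sup f) Q := by
    intro Q
    have := Seminorm.le_finset_sup_apply (p := f) (x := Q)
      (Finset.mem_range.2 (Nat.pos_of_ne_zero hn))
    rw [hfa, pow_zero, one_mul] at this
    exact this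
  refine ⟨(Finset.range n).sup f, hspan, fun Q => ?_, fun Q Q' => ?_⟩
  · refine Seminorm.finset_sup_apply_le (by linarith [hpos Q]) fun k hk => ?_
    rw [hfa]
    refine mul_le_mul ?_ (M.multiStep_le_span k Q) (apply_nonneg _ _) zero_le_two
    rw [inv_pow, inv_le_comm₀ (by positivity) two_pos]
    have : β ^ n ≤ β ^ k := pow_le_pow_of_le_one hβ.le hβ1 (Finset.mem_range.1 hk).le
    linarith
  · refine Seminorm.finset_sup_apply_le (mul_nonneg hβ.le (apply_nonneg _ _)) fun k hk => ?_
    rw [lazyBellman_sub, hfa]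
    have h1 := M.multiStep_lazyStep_le k (maxQ_sub_maxQ_mem Q Q')
    have hβk : 0 ≤ β⁻¹ ^ k := by positivity
    have e : β⁻¹ ^ k = β * β⁻¹ ^ (k + 1) := by
      rw [pow_succ]
      field_simp
    refine (mul_le_mul_of_nonneg_left h1 hβk).trans ?_
    rw [e, mul_assoc]
    refine mul_le_mul_of_nonneg_left ?_ hβ.le
    rcases lt_or_eq_of_le (Nat.succ_le_of_lt (Finset.mem_range.1 hk)) with h | h
    · have := Seminorm.le_finset_sup_apply (p := f) (x := Q - Q') (Finset.mem_range.2 h)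
      rwa [hfa] at this
    · rw [show k + 1 = n from h]
      refine le_trans ?_ (hspan _)
      rw [inv_pow, inv_mul_le_iff₀ (by positivity)]
      exact (hδ _).trans (mul_le_mul_of_nonneg_right hβδ (hpos _))

end Seminorms

/-! ### The controlled chain: Markov property and hitting times -/

section PolicyStep

variable {S : Type u} {A : Type v} [Fintype S]

/-- The transition operator `φ ↦ ∑ s', p(s' | s, π(s)) φ(s')` of a policy. -/
noncomputable def policyStep (M : AMDP S A) (π : S → A) : Module.End ℝ (S → ℝ) where
  toFun φ s := ∑ s', M.p s (π s) s' * φ s'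
  map_add' x y := by
    funext s
    simp only [Pi.add_apply, mul_add, Finset.sum_add_distrib]
  map_smul' c x := by
    funext s
    simp only [Pi.smul_apply, smul_eq_mul, RingHom.id_apply, Finset.mul_sum]
    exact Finset.sum_congr rfl fun i _ => by ring

lemma policyStep_apply (M : AMDP S A) (π : S → A) (φ : S → ℝ) (s : S) :
    M.policyStep π φ s = ∑ s', M.p s (π s) s' * φ s' := rfl

variable [DecidableEq S]

/-- The transition operator of a policy killed at the state `sd`. -/
noncomputable def killedStep (M : AMDP S A) (π : S → A) (sd : S) : Module.End ℝ (S → ℝ) where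
  toFun φ := M.policyStep π fun s' => if s' = sd then 0 else φ s'
  map_add' x y := by
    rw [← map_add]
    congr 1
    funext s
    by_cases h : s = sd <;> simp [h]
  map_smul' c x := by
    rw [← map_smul]
    congr 1
    funext s
    by_cases h : s = sd <;> simp [h]

lemma killedStep_apply (M : AMDP S A) (π : S → A) (sd : S) (φ : S → ℝ) (s : S) :
    M.killedStep π sd φ s = ∑ s', M.p s (π s) s' * (if s' = sd then 0 else φ s') := rfl

lemma killedStep_mono (M : AMDP S A) (π : S → A) (sd : S) {φ ψ : S → ℝ} (h : φ ≤ ψ) :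
    M.killedStep π sd φ ≤ M.killedStep π sd ψ := by
  intro s
  rw [killedStep_apply, killedStep_apply]
  refine Finset.sum_le_sum fun s' _ => mul_le_mul_of_nonneg_left ?_ (M.p_nonneg _ _ _)
  split_ifs
  · exact le_rfl
  · exact h s'

lemma killedStep_pow_mono (M : AMDP S A) (π : S → A) (sd : S) (n : ℕ) {φ ψ : S → ℝ} (h : φ ≤ ψ) :
    (M.killedStep π sd ^ n) φ ≤ (M.killedStep π sd ^ n) ψ := by
  induction n with
  | zero => simpa using h
  | succ n ih =>
    rw [pow_succ', Module.End.mul_apply, Module.End.mul_apply]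
    exact M.killedStep_mono π sd ih

lemma killedStep_one_le (M : AMDP S A) (π : S → A) (sd : S) : M.killedStep π sd 1 ≤ 1 := by
  intro s
  rw [killedStep_apply, Pi.one_apply, ← M.p_sum s (π s)]
  refine Finset.sum_le_sum fun s' _ => ?_
  have := M.p_nonneg s (π s) s'
  split_ifs <;> simp [this]

/-- The probability that the chain of `π` started at `s` avoids `sd` at the times `1, …, n`. -/
noncomputable def survival (M : AMDP S A) (π : S → A) (sd : S) (n : ℕ) : S → ℝ :=
  (M.killedStep π sd ^ n) 1

lemma survival_nonneg (M : AMDP S A) (π : S → A) (sd : S) (n : ℕ) (s : S) :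
    0 ≤ M.survival π sd n s := by
  have := M.killedStep_pow_mono π sd n (zero_le_one (α := S → ℝ)) s
  rwa [map_zero] at this

lemma survival_antitone (M : AMDP S A) (π : S → A) (sd : S) : Antitone (M.survival π sd) := by
  refine antitone_nat_of_succ_le fun n => ?_
  rw [survival, pow_succ, Module.End.mul_apply]
  exact M.killedStep_pow_mono π sd n (M.killedStep_one_le π sd)

lemma survival_succ (M : AMDP S A) (π : S → A) (sd : S) (n : ℕ) :
    M.survival π sd (n + 1) = M.killedStep π sd (M.survival π sd n) := by
  rw [survival, pow_succ', Module.End.mul_apply, survival]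

/-- If every state has a positive probability of reaching `sd`, then the survival probabilities are
summable, with a bound on the partial sums. -/
lemma exists_sum_survival_le [Nonempty S] (M : AMDP S A) (π : S → A) (sd : S)
    (h : ∀ s, ∃ n, M.survival π sd n s < 1) :
    ∃ B, ∀ N s, ∑ k ∈ Finset.range N, M.survival π sd k s ≤ B := by
  choose n hn using h
  set m := Finset.univ.sup n with hm
  have hlt : ∀ s, M.survival π sd m s < 1 := fun s =>
    (M.survival_antitone π sd (Finset.le_sup (Finset.mem_univ s)) s).trans_lt (hn s)
  obtain ⟨s₀, hs₀⟩ := Finite.exists_max (M.survival π sd m)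
  set ρ := M.survival π sd m s₀ with hρ
  have hρ0 : 0 ≤ ρ := M.survival_nonneg π sd m s₀
  have hρ1 : ρ < 1 := hlt s₀
  set H : ℕ → S → ℝ := fun N => ∑ k ∈ Finset.range N, M.survival π sd k with hH
  have hHle : ∀ N s, H N s ≤ N := by
    intro N s
    simp only [hH, Finset.sum_apply]
    calc _ ≤ ∑ k ∈ Finset.range N, (1 : ℝ) := Finset.sum_le_sum fun k _ => by
          have := M.survival_antitone π sd (Nat.zero_le k) s
          simpa [survival] using this
      _ = N := by simp
  refine ⟨m / (1 - ρ), fun N s => ?_⟩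
  rw [← Finset.sum_apply]
  change H N s ≤ _
  obtain ⟨s₁, hs₁⟩ := Finite.exists_max (H N)
  have hc0 : 0 ≤ H N s₁ := by
    simp only [hH, Finset.sum_apply]
    exact Finset.sum_nonneg fun k _ => M.survival_nonneg π sd k s₁
  have h1 : H N s₁ ≤ H (m + N) s₁ := by
    simp only [hH, Finset.sum_apply]
    exact Finset.sum_le_sum_of_subset_of_nonneg (Finset.range_mono (Nat.le_add_left _ _))
      fun k _ _ => M.survival_nonneg π sd k s₁
  have h2 : H (m + N) = H m + (M.killedStep π sd ^ m) (H N) := by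
    simp only [hH]
    rw [Finset.sum_range_add, map_sum]
    congr 1
    refine Finset.sum_congr rfl fun k _ => ?_
    rw [survival, pow_add, Module.End.mul_apply, survival]
  have h3 : (M.killedStep π sd ^ m) (H N) s₁ ≤ H N s₁ * ρ := by
    have : H N ≤ H N s₁ • (1 : S → ℝ) := fun s => by simpa using hs₁ s
    have := M.killedStep_pow_mono π sd m this s₁
    rw [map_smul, Pi.smul_apply, smul_eq_mul] at this
    exact this.trans (mul_le_mul_of_nonneg_left (hs₀ s₁) hc0)
  have h4 := hHle m s₁
  rw [h2, Pi.add_apply] at h1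
  rw [le_div_iff₀ (by linarith)]
  have := hs₁ s
  nlinarith

/-- The expected hitting time of `sd` at a positive time, as the sum of the survival
probabilities. -/
noncomputable def expHit (M : AMDP S A) (π : S → A) (sd : S) (s : S) : ℝ :=
  ∑' k, M.survival π sd k s

lemma summable_survival {M : AMDP S A} {π : S → A} {sd : S} {B : ℝ}
    (hB : ∀ N s, ∑ k ∈ Finset.range N, M.survival π sd k s ≤ B) (s : S) :
    Summable fun k => M.survival π sd k s :=
  summable_of_sum_range_le (fun k => M.survival_nonneg π sd k s) fun N => hB N s

lemma expHit_eq {M : AMDP S A} {π : S → A} {sd : S}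
    (hs : ∀ s, Summable fun k => M.survival π sd k s) (s : S) :
    M.expHit π sd s = 1 + M.killedStep π sd (M.expHit π sd) s := by
  rw [expHit, (hs s).tsum_eq_zero_add]
  congr 1
  rw [killedStep_apply]
  have : ∀ s', M.p s (π s) s' * (if s' = sd then 0 else M.expHit π sd s') =
      ∑' k, M.p s (π s) s' * (if s' = sd then 0 else M.survival π sd k s') := by
    intro s'
    split_ifs
    · simp
    · rw [tsum_mul_left, expHit]
  simp_rw [this]
  rw [← Summable.tsum_finsetSum]
  · refine tsum_congr fun k => ?_
    rw [survival_succ, killedStep_apply]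
  · intro s' _
    split_ifs
    · simp
    · exact (hs s').mul_left _

lemma one_le_expHit {M : AMDP S A} {π : S → A} {sd : S}
    (hs : ∀ s, Summable fun k => M.survival π sd k s) (s : S) : 1 ≤ M.expHit π sd s := by
  have := (hs s).le_tsum 0 fun k _ => M.survival_nonneg π sd k s
  simpa [survival, expHit] using this

/-- Comparison principle for the killed operator: the ratio of a subharmonic function to the
expected hitting time has no positive maximum. -/
lemma nonpos_of_le_killedStep [Nonempty S] {M : AMDP S A} {π : S → A} {sd : S}
    (hs : ∀ s, Summable fun k => M.survival π sd k s) {d : S → ℝ}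
    (hd : ∀ s, d s ≤ M.killedStep π sd d s) (s : S) : d s ≤ 0 := by
  set h := M.expHit π sd with hh
  have h1 : ∀ s, 1 ≤ h s := one_le_expHit hs
  obtain ⟨s₀, hs₀⟩ := Finite.exists_max fun s => d s / h s
  set ρ := d s₀ / h s₀ with hρ
  have hle : ∀ s, d s ≤ ρ * h s := fun s => (div_le_iff₀ (by linarith [h1 s])).1 (hs₀ s)
  by_contra! hpos
  have hρpos : 0 < ρ := by
    have := hle s
    by_contra! hneg
    nlinarith [h1 s]
  have h2 : M.killedStep π sd d s₀ ≤ ρ * M.killedStep π sd h s₀ := by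
    have : d ≤ ρ • h := fun s => hle s
    have := M.killedStep_mono π sd this s₀
    rwa [map_smul] at this
  have h3 := expHit_eq hs s₀
  rw [← hh] at h3
  have h4 : d s₀ = ρ * h s₀ := by
    rw [hρ]
    have := h1 s₀
    field_simp
  have h5 := hd s₀
  nlinarith

/-- Policy improvement: a policy that maximises the sum over the states of the expected hitting
times satisfies the optimality inequality for every action. -/
lemma exists_lyapunov_of_summable [Nonempty S] [Fintype A] [Nonempty A] (M : AMDP S A) (sd : S)
    (hs : ∀ π s, Summable fun k => M.survival π sd k s) :
    ∃ π, ∀ s a, 1 + ∑ s', M.p s a s' * (if s' = sd then 0 else M.expHit π sd s') ≤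
      M.expHit π sd s := by
  classical
  obtain ⟨π, hπ⟩ := Finite.exists_max fun π : S → A => ∑ s, M.expHit π sd s
  refine ⟨π, fun s₀ a => ?_⟩
  by_contra! hlt
  set π' := Function.update π s₀ a with hπ'
  have hstep : ∀ s, M.expHit π sd s ≤ 1 + M.killedStep π' sd (M.expHit π sd) s := by
    intro s
    by_cases h : s = s₀
    · subst h
      rw [killedStep_apply, hπ', Function.update_self]
      exact hlt.le
    · rw [expHit_eq (hs π) s, killedStep_apply, killedStep_apply, hπ', Function.update_of_ne h]
  have hle : ∀ s, M.expHit π sd s ≤ M.expHit π' sd s := by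
    intro s
    have := nonpos_of_le_killedStep (hs π') (d := M.expHit π sd - M.expHit π' sd) (fun s => by
      rw [map_sub, Pi.sub_apply, Pi.sub_apply]
      have h1 := hstep s
      have h2 := expHit_eq (hs π') s
      linarith) s
    rw [Pi.sub_apply] at this
    linarith
  have heq : ∀ s, M.expHit π sd s = M.expHit π' sd s := by
    have := (Finset.sum_eq_sum_iff_of_le fun s _ => hle s).1
      (le_antisymm (Finset.sum_le_sum fun s _ => hle s) (hπ π'))
    exact fun s => this s (Finset.mem_univ s)
  have h1 := expHit_eq (hs π') s₀
  rw [killedStep_apply, hπ', Function.update_self, ← hπ', ← heq s₀] at h1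
  simp only [← heq] at h1
  exact hlt.ne h1

end PolicyStep

section HitTime

variable {S : Type u}

lemma hitTime_eq_tsum (sd : S) (x : ℕ → S) :
    hitTime sd x =
      ∑' n, {x : ℕ → S | ∀ t, 0 < t → t ≤ n → x t ≠ sd}.indicator (1 : (ℕ → S) → ℝ≥0∞) x := by
  classical
  by_cases h : ∃ t, 0 < t ∧ x t = sd
  · have hspec := Nat.find_spec h
    have e : ∀ n, {x : ℕ → S | ∀ t, 0 < t → t ≤ n → x t ≠ sd}.indicator
        (1 : (ℕ → S) → ℝ≥0∞) x = if n ∈ Finset.range (Nat.find h) then 1 else 0 := by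
      intro n
      rw [Set.indicator_apply, Pi.one_apply]
      refine if_congr ?_ rfl rfl
      rw [Set.mem_ofPred_eq, Finset.mem_range]
      refine ⟨fun hx => ?_, fun hn t h1 h2 h3 => Nat.find_min h (h2.trans_lt hn) ⟨h1, h3⟩⟩
      by_contra! hle
      exact hx _ hspec.1 hle hspec.2
    simp_rw [e]
    rw [tsum_eq_sum (s := Finset.range (Nat.find h)) fun b hb => if_neg hb,
      Finset.sum_congr rfl fun n hn => if_pos hn]
    simp only [Finset.sum_const, Finset.card_range, nsmul_eq_mul, mul_one]
    refine le_antisymm (iInf₂_le (f := fun (t : ℕ) (_ : 0 < t ∧ x t = sd) => (t : ℝ≥0∞)) _ hspec)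
      (le_iInf₂ fun t ht => ?_)
    exact_mod_cast Nat.find_min' h ht
  · push Not at h
    have h1 : hitTime sd x = ∞ := by
      rw [hitTime, iInf₂_eq_top]
      exact fun t ht => absurd ht.2 (h t ht.1)
    rw [h1]
    symm
    have : ∀ n, {x : ℕ → S | ∀ t, 0 < t → t ≤ n → x t ≠ sd}.indicator
        (1 : (ℕ → S) → ℝ≥0∞) x = 1 := fun n => by
      rw [Set.indicator_of_mem]
      · rfl
      · exact fun t h1 _ => h t h1
    simp_rw [this]
    exact ENNReal.tsum_const_eq_top_of_ne_zero one_ne_zero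

variable [MeasurableSpace S] [MeasurableSingletonClass S]

lemma measurableSet_eval_eq (sd : S) (t : ℕ) : MeasurableSet {x : ℕ → S | x t = sd} :=
  measurable_pi_apply (X := fun _ : ℕ => S) t (measurableSet_singleton sd)

lemma measurableSet_avoid (sd : S) (n : ℕ) :
    MeasurableSet {x : ℕ → S | ∀ t, 0 < t → t ≤ n → x t ≠ sd} := by
  simp only [Set.ofPred_forall]
  refine MeasurableSet.iInter fun t => MeasurableSet.iInter fun _ =>
    MeasurableSet.iInter fun _ => ?_
  exact (measurableSet_eval_eq sd t).compl

end HitTime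

section Path

variable {S : Type u} {A : Type v} [Fintype S] [MeasurableSpace S] [MeasurableSingletonClass S]

instance (M : AMDP S A) (π : S → A) (s : S) : IsProbabilityMeasure (M.pathMeasure π s) :=
  inferInstanceAs (IsProbabilityMeasure (Kernel.traj (X := fun _ => S) (M.historyKernel π) 0 _))

lemma integral_transitionMeasure (M : AMDP S A) (s : S) (a : A) (φ : S → ℝ) :
    ∫ s', φ s' ∂(M.transitionMeasure s a) = ∑ s', M.p s a s' * φ s' := by
  have : ∀ s' ∈ Finset.univ, Integrable φ (ENNReal.ofReal (M.p s a s') • Measure.dirac s') :=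
    fun s' _ => (Integrable.of_finite (μ := Measure.dirac s')).smul_measure ENNReal.ofReal_ne_top
  rw [transitionMeasure, integral_finsetSum_measure this]
  refine Finset.sum_congr rfl fun s' _ => ?_
  rw [integral_smul_measure, integral_dirac, ENNReal.toReal_ofReal (M.p_nonneg s a s'), smul_eq_mul]

lemma integral_pathMeasure_zero (M : AMDP S A) (π : S → A) (s : S) (φ : S → ℝ) :
    ∫ x, φ (x 0) ∂(M.pathMeasure π s) = φ s := by
  have h := Kernel.traj_map_frestrictLe_apply (X := fun _ => S) (κ := M.historyKernel π) 0 0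
    (fun _ => s)
  rw [Kernel.partialTraj_self, Kernel.id_apply] at h
  calc ∫ x, φ (x 0) ∂(M.pathMeasure π s)
      = ∫ z, φ (z ⟨0, Finset.mem_Iic.2 le_rfl⟩)
          ∂((M.pathMeasure π s).map (Preorder.frestrictLe (π := fun _ => S) 0)) := by
        rw [integral_map (by fun_prop) (Measurable.of_discrete.aestronglyMeasurable)]
        rfl
    _ = φ s := by
        rw [pathMeasure, h, integral_dirac]

/-- The Markov property of the trajectory. -/
lemma integral_pathMeasure_succ (M : AMDP S A) (π : S → A) (s : S) (n : ℕ)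
    (G : ((i : Finset.Iic n) → (fun _ : ℕ => S) i) → ℝ) (φ : S → ℝ) :
    ∫ x, G (Preorder.frestrictLe n x) * φ (x (n + 1)) ∂(M.pathMeasure π s) =
      ∫ x, G (Preorder.frestrictLe n x) * M.policyStep π φ (x n) ∂(M.pathMeasure π s) := by
  have h := Kernel.partialTraj_compProd_eq_map_traj (X := fun _ => S) (κ := M.historyKernel π)
    (Nat.zero_le n) (x₀ := fun _ => s)
  have h' := Kernel.traj_map_frestrictLe_apply (X := fun _ => S) (κ := M.historyKernel π) 0 n
    (fun _ => s)
  calc _ = ∫ z, G z.1 * φ z.2 ∂((M.pathMeasure π s).map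
          (fun x => (Preorder.frestrictLe (π := fun _ => S) n x, x (n + 1)))) := by
        rw [integral_map (by fun_prop) (Measurable.of_discrete.aestronglyMeasurable)]
    _ = ∫ y, ∫ s', G y * φ s' ∂(M.historyKernel π n y)
          ∂((M.pathMeasure π s).map (Preorder.frestrictLe (π := fun _ => S) n)) := by
        rw [pathMeasure, ← h, Measure.integral_compProd Integrable.of_finite, h']
    _ = _ := by
        rw [integral_map (by fun_prop) (Measurable.of_discrete.aestronglyMeasurable)]
        refine integral_congr_ae (ae_of_all _ fun x => ?_)
        simp only
        rw [integral_const_mul]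
        congr 1
        exact M.integral_transitionMeasure _ _ φ

lemma integral_pathMeasure_eq_pow (M : AMDP S A) (π : S → A) (s : S) (n : ℕ) (φ : S → ℝ) :
    ∫ x, φ (x n) ∂(M.pathMeasure π s) = (M.policyStep π ^ n) φ s := by
  induction n generalizing φ with
  | zero => simpa using M.integral_pathMeasure_zero π s φ
  | succ n ih =>
    have := M.integral_pathMeasure_succ π s n (fun _ => 1) φ
    simp only [one_mul] at this
    rw [this, ih, pow_succ, Module.End.mul_apply]

variable [DecidableEq S]

open Classical in
lemma integral_pathMeasure_avoid (M : AMDP S A) (π : S → A) (sd s : S) (n : ℕ) (φ : S → ℝ) :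
    ∫ x : ℕ → S, (if ∀ t, 0 < t → t ≤ n → x t ≠ sd then 1 else 0) * φ (x n) ∂(M.pathMeasure π s) =
      (M.killedStep π sd ^ n) φ s := by
  induction n generalizing φ with
  | zero =>
    have : ∀ x : ℕ → S, ∀ t, 0 < t → t ≤ 0 → x t ≠ sd := fun x t h1 h2 => by omega
    simp_rw [if_pos (this _), one_mul]
    simpa using M.integral_pathMeasure_zero π s φ
  | succ n ih =>
    rw [pow_succ, Module.End.mul_apply, ← ih]
    have h := M.integral_pathMeasure_succ π s n
      (fun y => if ∀ t : Finset.Iic n, 0 < (t : ℕ) → y t ≠ sd then 1 else 0)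
      (fun s' => if s' = sd then 0 else φ s')
    have e : ∀ x : ℕ → S, (∀ t : Finset.Iic n, 0 < (t : ℕ) →
        Preorder.frestrictLe (π := fun _ => S) n x t ≠ sd) ↔ ∀ t, 0 < t → t ≤ n → x t ≠ sd :=
      fun x => ⟨fun h t h1 h2 => h ⟨t, Finset.mem_Iic.2 h2⟩ h1,
        fun h t h1 => h t h1 (Finset.mem_Iic.1 t.2)⟩
    simp only [e] at h
    refine Eq.trans ?_ h
    refine integral_congr_ae (ae_of_all _ fun x => ?_)
    simp only
    by_cases h1 : ∀ t, 0 < t → t ≤ n → x t ≠ sd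
    · by_cases h2 : x (n + 1) = sd
      · rw [if_neg fun h => h (n + 1) n.succ_pos le_rfl h2, if_pos h2]
        ring
      · have : ∀ t, 0 < t → t ≤ n + 1 → x t ≠ sd := by
          intro t ht1 ht2
          rcases Nat.lt_or_ge n t with h3 | h3
          · rwa [show t = n + 1 by omega]
          · exact h1 t ht1 h3
        rw [if_pos this, if_pos h1, if_neg h2]
    · rw [if_neg h1, if_neg fun h => h1 fun t ht1 ht2 => h t ht1 (by omega)]
      ring

lemma pathMeasure_avoid (M : AMDP S A) (π : S → A) (sd s : S) (n : ℕ) :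
    (M.pathMeasure π s).real {x | ∀ t, 0 < t → t ≤ n → x t ≠ sd} = M.survival π sd n s := by
  classical
  have h := M.integral_pathMeasure_avoid π sd s n 1
  simp only [Pi.one_apply, mul_one] at h
  rw [survival, ← h, ← integral_indicator_one (measurableSet_avoid sd n)]
  refine integral_congr_ae (ae_of_all _ fun x => ?_)
  simp only [Set.indicator_apply, Set.mem_ofPred_eq, Pi.one_apply]

lemma exists_survival_lt_one (M : AMDP S A) {sd : S} (hR : M.Reachable sd) (π : S → A) (s : S) :
    ∃ n, M.survival π sd n s < 1 := by
  have key : ∀ s, s ≠ sd → ∃ n, M.survival π sd n s < 1 := by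
    intro s hs
    obtain ⟨t, ht⟩ := hR π s
    have ht0 : 0 < t := by
      rcases Nat.eq_zero_or_pos t with rfl | h
      · exfalso
        have h0 := M.integral_pathMeasure_zero π s (fun s' => if s' = sd then 1 else 0)
        rw [if_neg hs] at h0
        have : (M.pathMeasure π s).real {x | x 0 = sd} = 0 := by
          rw [← h0, ← integral_indicator_one (measurableSet_eval_eq sd 0)]
          refine integral_congr_ae (ae_of_all _ fun x => ?_)
          simp [Set.indicator_apply]
        rw [measureReal_eq_zero_iff] at this
        exact ht.ne' this
      · exact h
    refine ⟨t, ?_⟩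
    rw [← pathMeasure_avoid]
    have hsub : {x : ℕ → S | ∀ k, 0 < k → k ≤ t → x k ≠ sd} ⊆ {x | x t = sd}ᶜ :=
      fun x hx h => hx t ht0 le_rfl h
    refine (measureReal_mono hsub).trans_lt ?_
    rw [probReal_compl_eq_one_sub (measurableSet_eval_eq sd t)]
    have : 0 < (M.pathMeasure π s).real {x | x t = sd} :=
      ENNReal.toReal_pos ht.ne' (measure_ne_top _ _)
    linarith
  by_cases hs : s = sd
  · have : ∃ s', 0 < M.p s (π s) s' := by
      by_contra! h
      have := M.p_sum s (π s)
      rw [Finset.sum_eq_zero fun s' _ => le_antisymm (h s') (M.p_nonneg _ _ _)] at this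
      exact zero_ne_one this
    obtain ⟨s', hs'⟩ := this
    -- one step from `sd` reaches either `sd` itself or a state covered by the first case
    have hn : ∃ n, (if s' = sd then 0 else M.survival π sd n s') < 1 := by
      by_cases h : s' = sd
      · exact ⟨0, by simp [h]⟩
      · simpa [h] using key s' h
    obtain ⟨n, hn⟩ := hn
    refine ⟨n + 1, ?_⟩
    rw [survival_succ, killedStep_apply, ← M.p_sum s (π s)]
    refine Finset.sum_lt_sum (fun x _ => ?_) ⟨s', Finset.mem_univ _, ?_⟩
    · refine mul_le_of_le_one_right (M.p_nonneg _ _ _) ?_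
      split_ifs
      · exact zero_le_one
      · have := M.survival_antitone π sd (Nat.zero_le n) x
        simpa [survival] using this
    · exact mul_lt_of_lt_one_right hs' hn
  · exact key s hs

lemma lintegral_hitTime {M : AMDP S A} {π : S → A} {sd : S}
    (hs : ∀ s, Summable fun k => M.survival π sd k s) (s : S) :
    ∫⁻ x, hitTime sd x ∂(M.pathMeasure π s) = ENNReal.ofReal (M.expHit π sd s) := by
  simp_rw [hitTime_eq_tsum]
  rw [lintegral_tsum fun n => (measurable_one.indicator (measurableSet_avoid sd n)).aemeasurable,
    expHit, ENNReal.ofReal_tsum_of_nonneg (fun n => M.survival_nonneg π sd n s) (hs s)]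
  refine tsum_congr fun n => ?_
  rw [lintegral_indicator_one (measurableSet_avoid sd n), ← pathMeasure_avoid, ofReal_measureReal]

/-- Reachability yields a finite `K` and a Lyapunov function bounded by `K`: the expected hitting
times under the slowest policy. -/
theorem exists_lyapunov [Nonempty S] [Fintype A] [Nonempty A] (M : AMDP S A) {sd : S}
    (hR : M.Reachable sd) :
    M.maxHitTime sd ≠ ∞ ∧ ∃ W : S → ℝ, (∀ s, 1 ≤ W s) ∧ (∀ s, W s ≤ M.hitConst sd) ∧
      ∀ s a, 1 + ∑ s', M.p s a s' * (if s' = sd then 0 else W s') ≤ W s := by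
  have hs : ∀ π s, Summable fun k => M.survival π sd k s := fun π => by
    obtain ⟨B, hB⟩ := M.exists_sum_survival_le π sd (M.exists_survival_lt_one hR π)
    exact summable_survival hB
  have hfin : M.maxHitTime sd ≠ ∞ := by
    have : M.maxHitTime sd = ⨆ z : (S → A) × S, ENNReal.ofReal (M.expHit z.1 sd z.2) := by
      rw [maxHitTime, iSup_prod]
      simp_rw [lintegral_hitTime (hs _)]
    rw [this]
    obtain ⟨z, hz⟩ := exists_eq_ciSup_of_finite
      (f := fun z : (S → A) × S => ENNReal.ofReal (M.expHit z.1 sd z.2))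
    rw [← hz]
    exact ENNReal.ofReal_ne_top
  refine ⟨hfin, ?_⟩
  obtain ⟨π, hπ⟩ := M.exists_lyapunov_of_summable sd hs
  refine ⟨M.expHit π sd, one_le_expHit (hs π), fun s => ?_, hπ⟩
  rw [hitConst, ← ENNReal.ofReal_le_iff_le_toReal hfin, ← lintegral_hitTime (hs π)]
  exact le_iSup₂ (f := fun (π : S → A) (s : S) => ∫⁻ x, hitTime sd x ∂(M.pathMeasure π s)) π s

end Path

/-! ### One-step contraction in terms of `K` -/

/-- The constant `K (K + 1) 2 ^ K`; the lazy Bellman operator contracts with modulus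
`1 - 1 / (2 K (K + 1) 2 ^ K)`. -/
noncomputable def contrConst (K : ℝ) : ℝ := K * (K + 1) * (2 : ℝ) ^ K

lemma four_le_contrConst {K : ℝ} (hK : 1 ≤ K) : 4 ≤ contrConst K := by
  have h1 : (2 : ℝ) ≤ 2 ^ K := by
    simpa using Real.rpow_le_rpow_of_exponent_le one_le_two hK
  have h2 : 2 ≤ K * (K + 1) := by nlinarith
  unfold contrConst
  nlinarith

/-- The number of lazy steps is `⌊K⌋` if the fractional part of `K` is at most `1 / 2`, and
`⌊K⌋ + 1` otherwise: if `K` is only slightly below `⌊K⌋ + 1`, then `1 - K / (n + 1)` is too close to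
zero for `n = ⌊K⌋`. -/
lemma exists_steps {K : ℝ} (hK : 1 ≤ K) :
    ∃ n : ℕ, n ≠ 0 ∧ n / (2 * contrConst K) ≤ (1 / 2) ^ n * (1 - K / (n + 1)) := by
  set k := ⌊K⌋₊ with hk
  have hk1 : 1 ≤ k := Nat.le_floor (by simpa using hK)
  have hkK : (k : ℝ) ≤ K := Nat.floor_le (by linarith)
  have hKk : K < k + 1 := Nat.lt_floor_add_one K
  have hk1' : (1 : ℝ) ≤ k := by exact_mod_cast hk1
  have hpow : (2 : ℝ) ^ K = 2 ^ k * (2 : ℝ) ^ (K - k) := by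
    rw [← Real.rpow_natCast, ← Real.rpow_add two_pos]
    congr 1
    ring
  have hκ := four_le_contrConst hK
  have hhalf : ∀ n : ℕ, ((1 : ℝ) / 2) ^ n * 2 ^ n = 1 := fun n => by
    rw [← mul_pow]
    norm_num
  have hp2 := hhalf k
  rcases le_total (K - k) (1 / 2) with hf | hf
  · refine ⟨k, by omega, ?_⟩
    have hf1 : (1 : ℝ) ≤ (2 : ℝ) ^ (K - k) := Real.one_le_rpow one_le_two (by linarith)
    rw [div_le_iff₀ (by linarith), one_sub_div (by positivity), contrConst, hpow]
    have e : (1 / 2) ^ k * ((k + 1 - K) / (k + 1)) *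
        (2 * (K * (K + 1) * (2 ^ k * (2 : ℝ) ^ (K - k)))) =
        (K * (K + 1) * (2 * (k + 1 - K) * (2 : ℝ) ^ (K - k))) / (k + 1) *
          ((1 / 2) ^ k * 2 ^ k) := by ring
    rw [e, hp2, mul_one, le_div_iff₀ (by positivity)]
    have h1 : 1 ≤ 2 * (k + 1 - K) * (2 : ℝ) ^ (K - k) := by nlinarith
    have h2 : (k : ℝ) * (k + 1) ≤ K * (K + 1) := by gcongr
    exact h2.trans (le_mul_of_one_le_right (by positivity) h1)
  · refine ⟨k + 1, by omega, ?_⟩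
    have hf1 : (1.4 : ℝ) ≤ (2 : ℝ) ^ (K - k) := by
      calc (1.4 : ℝ) ≤ √2 := Real.le_sqrt_of_sq_le (by norm_num)
        _ = (2 : ℝ) ^ (1 / 2 : ℝ) := Real.sqrt_eq_rpow 2
        _ ≤ _ := Real.rpow_le_rpow_of_exponent_le one_le_two hf
    rw [div_le_iff₀ (by linarith), one_sub_div (by positivity), contrConst, hpow]
    push_cast
    have e : (1 / 2) ^ (k + 1) * (((k : ℝ) + 1 + 1 - K) / (k + 1 + 1)) *
        (2 * (K * (K + 1) * (2 ^ k * (2 : ℝ) ^ (K - k)))) =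
        (K * (K + 1) * ((k + 2 - K) * (2 : ℝ) ^ (K - k))) / (k + 1 + 1) *
          ((1 / 2) ^ k * 2 ^ k) := by ring
    rw [e, hp2, mul_one, le_div_iff₀ (by positivity)]
    obtain ⟨f, hfK⟩ : ∃ f, f = K - k := ⟨_, rfl⟩
    have h0 : 0 ≤ K * (K + 1) * (k + 2 - K) := by
      have : 0 ≤ (k : ℝ) + 2 - K := by linarith
      positivity
    have h1 : (k + 1 : ℝ) * (k + 1 + 1) ≤ K * (K + 1) * (k + 2 - K) * 1.4 := by
      have hK' : K = k + f := by linarith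
      rw [hK'] at hKk ⊢
      rw [← hfK] at hf
      obtain ⟨j, hj⟩ : ∃ j : ℝ, (k : ℝ) = 1 + j := ⟨k - 1, by ring⟩
      have hj0 : 0 ≤ j := by linarith
      have hf2 : f < 1 := by linarith
      rw [hj]
      -- as a polynomial in `j`, every coefficient of the difference is nonnegative for `f` in
      -- `[1 / 2, 1]`
      have c0 : 6 ≤ (4 - f ^ 2) * (1 + f) * 1.4 := by
        nlinarith [mul_nonneg (sub_nonneg.2 hf) (sub_nonneg.2 hf2.le)]
      have c1 : 5 ≤ (3 + 2 * f) * (2 - f) * 1.4 := by nlinarith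
      have c2 : 1 ≤ (2 - f) * 1.4 := by linarith
      nlinarith [mul_nonneg hj0 (sub_nonneg.2 c1),
        mul_nonneg (mul_nonneg hj0 hj0) (sub_nonneg.2 c2)]
    have h2 := mul_le_mul_of_nonneg_left hf1 h0
    linarith

section Contraction

variable {S : Type u} {A : Type v} [Fintype S] [Fintype A] [Nonempty A] [Nonempty S]

theorem exists_contracting_seminorm [DecidableEq S] (M : AMDP S A) {sd : S} {W : S → ℝ} {K : ℝ}
    (hW1 : ∀ s, 1 ≤ W s) (hWK : ∀ s, W s ≤ K)
    (hW : ∀ s a, 1 + ∑ s', M.p s a s' * (if s' = sd then 0 else W s') ≤ W s) :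
    ∃ N : Seminorm ℝ (S → A → ℝ), (∀ Q, span Q ≤ N Q) ∧ (∀ Q, N Q ≤ 2 * span Q) ∧
      ∀ Q Q', N (M.lazyBellman Q - M.lazyBellman Q') ≤
        (1 - 1 / (2 * contrConst K)) * N (Q - Q') := by
  have hK : 1 ≤ K := (hW1 sd).trans (hWK sd)
  have hκ := four_le_contrConst hK
  obtain ⟨n, hn0, hn⟩ := exists_steps hK
  have hinv : 1 / (2 * contrConst K) ≤ 1 / 8 := by
    apply one_div_le_one_div_of_le <;> linarith
  have hinv0 : 0 < 1 / (2 * contrConst K) := by positivity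
  refine M.exists_seminorm hn0 (δ := (1 / 2) ^ n * (1 - K / (n + 1))) (by linarith) (by linarith)
    (fun Q => M.multiStep_le hW1 hWK hW hn0 Q) ?_ ?_
  · have h1 : ((1 : ℝ) / 2) ^ n ≤ 1 / 2 := pow_le_of_le_one (by norm_num) (by norm_num) hn0
    have h2 : 1 - K / (n + 1) ≤ 1 := by
      have : 0 ≤ K / (n + 1) := by positivity
      linarith
    have h3 : (0 : ℝ) < (1 / 2) ^ n := by positivity
    nlinarith
  · have := one_add_mul_le_pow (a := -(1 / (2 * contrConst K))) (by linarith) n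
    rw [← sub_eq_add_neg] at this
    refine le_trans ?_ this
    rw [div_eq_mul_one_div] at hn
    linarith

end Contraction

/-! ### Bellman equation and average rewards -/

section Poisson

variable {S : Type u} {A : Type v} [Fintype S]

/-- The decision process in which every action is replaced by the one that `π` prescribes. -/
def freeze (M : AMDP S A) (π : S → A) : AMDP S A where
  p s _ := M.p s (π s)
  r s _ := M.r s (π s)
  p_nonneg s _ := M.p_nonneg s (π s)
  p_sum s _ := M.p_sum s (π s)
  r_nonneg s _ := M.r_nonneg s (π s)
  r_le_one s _ := M.r_le_one s (π s)

/-- `h` and `g` solve the Poisson equation of the policy `π`. -/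
def IsPoisson (M : AMDP S A) (π : S → A) (h : S → ℝ) (g : ℝ) : Prop :=
  ∀ s, M.r s (π s) + M.policyStep π h s = h s + g

lemma isPoisson_of_isOptimalQ_freeze [Fintype A] [Nonempty A] (M : AMDP S A) {π : S → A}
    {g : ℝ} {Q : S → A → ℝ} (h : (M.freeze π).IsOptimalQ g Q) : M.IsPoisson π (maxQ Q) g := by
  intro s
  obtain ⟨a, ha⟩ := exists_eq_maxQ Q s
  have := h s a
  rw [← ha, policyStep_apply, ← this]
  simp only [bellman, freeze]
  ring

lemma hasGain_of_isPoisson [Nonempty S] [MeasurableSpace S] [MeasurableSingletonClass S]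
    (M : AMDP S A) {π : S → A} {h : S → ℝ} {g : ℝ} (hp : M.IsPoisson π h g) : M.HasGain π g := by
  intro s
  have hone : ∀ n, (M.policyStep π ^ n) 1 = 1 := by
    intro n
    induction n with
    | zero => rfl
    | succ n ih =>
      rw [pow_succ', Module.End.mul_apply, ih]
      funext s
      simp [policyStep_apply, M.p_sum]
  have hr : (fun s => M.r s (π s)) = h - M.policyStep π h + g • 1 := by
    funext s
    have := hp s
    simp only [Pi.add_apply, Pi.sub_apply, Pi.smul_apply, Pi.one_apply, smul_eq_mul, mul_one]
    linarith
  have hsum : ∀ n, ∑ t ∈ Finset.range n, (M.policyStep π ^ t) (fun s => M.r s (π s)) s =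
      h s - (M.policyStep π ^ n) h s + n * g := by
    intro n
    induction n with
    | zero => simp
    | succ n ih =>
      rw [Finset.sum_range_succ, ih, hr, map_add, map_sub, map_smul, hone,
        ← Module.End.mul_apply, ← pow_succ]
      simp only [Pi.add_apply, Pi.sub_apply, Pi.smul_apply, Pi.one_apply, smul_eq_mul, mul_one]
      push_cast
      ring
  have hint : ∀ t, Integrable (fun x : ℕ → S => M.r (x t) (π (x t))) (M.pathMeasure π s) := by
    intro t
    have hm : Measurable fun x : ℕ → S => M.r (x t) (π (x t)) :=
      (Measurable.of_discrete (f := fun s => M.r s (π s))).comp (measurable_pi_apply t)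
    refine Integrable.of_mem_Icc 0 1 hm.aemeasurable (ae_of_all _ fun x => ?_)
    exact ⟨M.r_nonneg _ _, M.r_le_one _ _⟩
  have havg : ∀ n : ℕ, M.averageReward π s n =
      1 / (n : ℝ) * (h s - (M.policyStep π ^ n) h s + n * g) := by
    intro n
    rw [averageReward, integral_finsetSum _ fun t _ => hint t, ← hsum]
    congr 1
    exact Finset.sum_congr rfl fun t _ =>
      M.integral_pathMeasure_eq_pow π s t (fun s => M.r s (π s))
  obtain ⟨B, hB⟩ : ∃ B, ∀ s, h s ∈ Set.Icc (-B) B := by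
    obtain ⟨s₁, hs₁⟩ := Finite.exists_max fun s => |h s|
    exact ⟨|h s₁|, fun s => abs_le.1 (hs₁ s)⟩
  have hpow : ∀ n s, (M.policyStep π ^ n) h s ∈ Set.Icc (-B) B := by
    intro n
    induction n with
    | zero => simpa using hB
    | succ n ih =>
      intro s
      rw [pow_succ', Module.End.mul_apply]
      exact M.sum_p_mul_mem_Icc ih s (π s)
  have hlim : Tendsto (fun n : ℕ => 1 / (n : ℝ) * (h s - (M.policyStep π ^ n) h s) + g) atTop
      (𝓝 (0 + g)) := by
    refine Tendsto.add_const g ?_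
    refine squeeze_zero_norm (a := fun n : ℕ => 1 / (n : ℝ) * (2 * B)) (fun n => ?_) ?_
    · rw [norm_mul, Real.norm_of_nonneg (by positivity : (0 : ℝ) ≤ 1 / n)]
      refine mul_le_mul_of_nonneg_left ?_ (by positivity)
      rw [Real.norm_eq_abs, abs_le]
      have h1 := hB s
      have h2 := hpow n s
      exact ⟨by linarith [h1.1, h2.2], by linarith [h1.2, h2.1]⟩
    · simpa using (tendsto_one_div_atTop_nhds_zero_nat (𝕜 := ℝ)).mul_const (2 * B)
  rw [zero_add] at hlim
  refine hlim.congr' ?_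
  filter_upwards [eventually_ne_atTop 0] with n hn
  rw [havg]
  have : (n : ℝ) ≠ 0 := by exact_mod_cast hn
  field_simp

end Poisson

section Bellman

variable {S : Type u} {A : Type v} [Fintype S] [Fintype A] [Nonempty A]

lemma continuous_lazyBellman (M : AMDP S A) : Continuous M.lazyBellman := by
  have h : ∀ s, Continuous fun Q : S → A → ℝ => maxQ Q s := continuous_maxQ
  refine continuous_pi fun s => continuous_pi fun a => ?_
  unfold lazyBellman
  simp only [lazyStep_apply]
  fun_prop

/-- The output correction turns a solution of the lazy Bellman equation into one of the original
equation with the same gain. -/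
lemma isOptimalQ_corrected (M : AMDP S A) {Q : S → A → ℝ} {g : ℝ}
    (h : ∀ s a, M.lazyBellman Q s a = Q s a + g) : M.IsOptimalQ g (corrected Q) := by
  have hmax : ∀ s, maxQ (corrected Q) s = 1 / 2 * maxQ Q s := by
    intro s
    have := maxQ_add_const Q (fun s => -(1 / 2 * maxQ Q s)) s
    simp only [← sub_eq_add_neg] at this
    change maxQ (fun s a => Q s a - 1 / 2 * maxQ Q s) s = _
    rw [this]
    ring
  intro s a
  have h1 := h s a
  simp only [bellman, hmax, corrected]
  rw [lazyBellman, lazyStep_apply] at h1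
  have : ∑ s', M.p s a s' * (1 / 2 * maxQ Q s') = 1 / 2 * ∑ s', M.p s a s' * maxQ Q s' := by
    rw [Finset.mul_sum]
    exact Finset.sum_congr rfl fun _ _ => by ring
  rw [this]
  linarith

/-- Conversely, every solution of the Bellman equation is the correction of a solution of the lazy
one. -/
lemma exists_lazy_of_isOptimalQ (M : AMDP S A) {Q : S → A → ℝ} {g : ℝ} (h : M.IsOptimalQ g Q) :
    ∃ Q', (∀ s a, M.lazyBellman Q' s a = Q' s a + g) ∧ corrected Q' = Q := by
  have hmax : ∀ s, maxQ (fun s a => Q s a + maxQ Q s) s = 2 * maxQ Q s := fun s => by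
    rw [maxQ_add_const]
    ring
  refine ⟨fun s a => Q s a + maxQ Q s, fun s a => ?_, ?_⟩
  · have h1 := h s a
    rw [bellman] at h1
    rw [lazyBellman, lazyStep_apply]
    simp only [hmax]
    have : ∑ s', M.p s a s' * (2 * maxQ Q s') = 2 * ∑ s', M.p s a s' * maxQ Q s' := by
      rw [Finset.mul_sum]
      exact Finset.sum_congr rfl fun _ _ => by ring
    rw [this]
    linarith
  · funext s a
    rw [corrected, hmax]
    ring

variable [Nonempty S]

lemma span_const (c : ℝ) : span (fun (_ : S) (_ : A) => c) = 0 := by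
  refine le_antisymm (span_le_iff.2 fun _ _ _ _ => by simp) ?_
  exact apply_nonneg (spanSeminorm S A) fun _ _ => c

lemma seminorm_const {N : Seminorm ℝ (S → A → ℝ)} (hN2 : ∀ Q, N Q ≤ 2 * span Q) (c : ℝ) :
    N (fun _ _ => c) = 0 := by
  have := hN2 (fun _ _ => c)
  rw [span_const, mul_zero] at this
  exact le_antisymm this (apply_nonneg N _)

/-- The lazy Bellman equation is solved by iterating the contraction modulo constants: the iterates
are normalised to vanish at one fixed pair, so that the span controls the supremum norm. -/
theorem exists_lazyBellman_eq (M : AMDP S A) {N : Seminorm ℝ (S → A → ℝ)} {β : ℝ} (hβ0 : 0 ≤ β)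
    (hβ1 : β < 1) (hN : ∀ Q, span Q ≤ N Q) (hN2 : ∀ Q, N Q ≤ 2 * span Q)
    (hc : ∀ Q Q', N (M.lazyBellman Q - M.lazyBellman Q') ≤ β * N (Q - Q')) :
    ∃ (Q : S → A → ℝ) (g : ℝ), ∀ s a, M.lazyBellman Q s a = Q s a + g := by
  obtain ⟨s₀⟩ := ‹Nonempty S›
  obtain ⟨a₀⟩ := ‹Nonempty A›
  set F : (S → A → ℝ) → (S → A → ℝ) := fun Q s a =>
    M.lazyBellman Q s a - M.lazyBellman Q s₀ a₀ with hF
  have hF0 : ∀ Q, F Q s₀ a₀ = 0 := fun Q => by simp [hF]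
  have hFc : ∀ Q Q', N (F Q - F Q') ≤ β * N (Q - Q') := by
    intro Q Q'
    have e : F Q - F Q' = (M.lazyBellman Q - M.lazyBellman Q') -
        (fun _ _ => M.lazyBellman Q s₀ a₀ - M.lazyBellman Q' s₀ a₀) := by
      funext s a
      simp only [hF, Pi.sub_apply]
      ring
    rw [e]
    refine (map_sub_le_add N _ _).trans ?_
    rw [seminorm_const hN2, add_zero]
    exact hc Q Q'
  set x : ℕ → S → A → ℝ := fun n => F^[n] 0 with hx
  have hxs : ∀ n, x (n + 1) = F (x n) := fun n => Function.iterate_succ_apply' F n 0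
  have hx0 : ∀ n, x n s₀ a₀ = 0 := by
    intro n
    cases n with
    | zero => rfl
    | succ n => rw [hxs, hF0]
  have hgeom : ∀ n, N (x n - x (n + 1)) ≤ N (x 0 - x 1) * β ^ n := by
    intro n
    induction n with
    | zero => simp
    | succ n ih =>
      rw [hxs n, hxs (n + 1)]
      refine (hFc _ _).trans ?_
      rw [pow_succ]
      nlinarith
  have hdist : ∀ n, dist (x n) (x (n + 1)) ≤ N (x 0 - x 1) * β ^ n := by
    intro n
    refine le_trans ?_ (hgeom n)
    have h0 := apply_nonneg N (x n - x (n + 1))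
    refine (dist_pi_le_iff h0).2 fun s => (dist_pi_le_iff h0).2 fun a => ?_
    rw [Real.dist_eq, abs_le]
    have h1 := (sub_le_span (x n - x (n + 1)) s s₀ a a₀).trans (hN _)
    have h2 := (sub_le_span (x n - x (n + 1)) s₀ s a₀ a).trans (hN _)
    simp only [Pi.sub_apply, hx0] at h1 h2
    constructor <;> linarith
  obtain ⟨Q, hQ⟩ := cauchySeq_tendsto_of_complete (cauchySeq_of_le_geometric β _ hβ1 hdist)
  have hFcont : Continuous F := by
    have h := M.continuous_lazyBellman
    have h' : ∀ s a, Continuous fun Q => M.lazyBellman Q s a := fun s a =>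
      (continuous_apply a).comp ((continuous_apply s).comp h)
    exact continuous_pi fun s => continuous_pi fun a => (h' s a).sub (h' s₀ a₀)
  have hfix := isFixedPt_of_tendsto_iterate hQ hFcont.continuousAt
  refine ⟨Q, M.lazyBellman Q s₀ a₀, fun s a => ?_⟩
  have := congrFun (congrFun hfix s) a
  simp only [hF] at this
  linarith

lemma gain_le (M : AMDP S A) {π : S → A} {h : S → ℝ} {g gStar : ℝ} {Q : S → A → ℝ}
    (hp : M.IsPoisson π h g) (hQ : M.IsOptimalQ gStar Q) : g ≤ gStar := by
  obtain ⟨s, hs⟩ := Finite.exists_min (maxQ Q - h)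
  have h1 : (maxQ Q - h) s ≤ M.policyStep π (maxQ Q - h) s :=
    (M.sum_p_mul_mem_Icc (c := Finset.univ.sup' Finset.univ_nonempty (maxQ Q - h))
      (fun s' => ⟨hs s', Finset.le_sup' _ (Finset.mem_univ s')⟩) s (π s)).1
  rw [map_sub, Pi.sub_apply, Pi.sub_apply] at h1
  have h2 := hp s
  have h3 := hQ s (π s)
  rw [bellman, ← policyStep_apply] at h3
  have h4 := le_maxQ Q s (π s)
  linarith

/-- The performance difference bound for a greedy policy, by the maximum principle applied to the
difference of the optimal value function and the Poisson solution of the policy. -/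
lemma gain_gap_le (M : AMDP S A) {π : S → A} {h : S → ℝ} {g gStar ε : ℝ} {Q Q' : S → A → ℝ}
    (hp : M.IsPoisson π h g) (hQ : M.IsOptimalQ gStar Q) (hπ : IsGreedy Q' π)
    (hε : span (fun s a => Q' s a - Q s a) ≤ ε) : gStar - g ≤ ε := by
  obtain ⟨s, hs⟩ := Finite.exists_max (maxQ Q - h)
  have h1 : M.policyStep π (maxQ Q - h) s ≤ (maxQ Q - h) s :=
    (M.sum_p_mul_mem_Icc (m := Finset.univ.inf' Finset.univ_nonempty (maxQ Q - h))
      (fun s' => ⟨Finset.inf'_le _ (Finset.mem_univ s'), hs s'⟩) s (π s)).2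
  rw [map_sub, Pi.sub_apply, Pi.sub_apply] at h1
  have h2 := hp s
  have h3 := hQ s (π s)
  rw [bellman, ← policyStep_apply] at h3
  obtain ⟨a, ha⟩ := exists_eq_maxQ Q s
  have h4 := hπ s a
  have h5 := (sub_le_span (fun s a => Q' s a - Q s a) s s (π s) a).trans hε
  linarith

lemma exists_isPoisson [DecidableEq S] (M : AMDP S A) {sd : S} {W : S → ℝ} {K : ℝ}
    (hW1 : ∀ s, 1 ≤ W s) (hWK : ∀ s, W s ≤ K)
    (hW : ∀ s a, 1 + ∑ s', M.p s a s' * (if s' = sd then 0 else W s') ≤ W s) (π : S → A) :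
    ∃ h g, M.IsPoisson π h g := by
  obtain ⟨N, hN1, hN2, hN3⟩ := (M.freeze π).exists_contracting_seminorm hW1 hWK
    fun s _ => hW s (π s)
  have hκ := four_le_contrConst ((hW1 sd).trans (hWK sd))
  have h1 : 1 / (2 * contrConst K) ≤ 1 := by
    rw [div_le_one (by positivity)]
    linarith
  have h2 : 0 < 1 / (2 * contrConst K) := by positivity
  obtain ⟨Q, g, hQ⟩ := (M.freeze π).exists_lazyBellman_eq (by linarith) (by linarith) hN1 hN2 hN3
  exact ⟨_, g, M.isPoisson_of_isOptimalQ_freeze ((M.freeze π).isOptimalQ_corrected hQ)⟩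

end Bellman

/-! ### Deterministic error analysis of the iteration -/

section Iteration

variable {S : Type u} {A : Type v} [Fintype S] [Fintype A] [Nonempty A]

/-- The exponentially weighted average of the sampling errors of the iterates. -/
noncomputable def noise (M : AMDP S A) (η : Variant) (lam : ℝ) (y : ℕ → S → A → S) :
    ℕ → S → A → ℝ
  | 0 => 0
  | t + 1 => fun s a => (1 - lam) * noise M η lam y t s a
      + lam * (M.empBellman η (y (t + 1)) (M.iterate η lam y t) s a
        - M.lazyBellman (M.iterate η lam y t) s a)

lemma empBellman_mem_Icc (M : AMDP S A) (η : Variant) {Q : S → A → ℝ} {b : ℝ}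
    (h : ∀ s a, Q s a ∈ Set.Icc 0 b) (y : S → A → S) (s : S) (a : A) :
    M.empBellman η y Q s a ∈ Set.Icc (M.r s a) (M.r s a + b) := by
  have hmax : ∀ s, maxQ Q s ∈ Set.Icc 0 b := fun s =>
    ⟨(h s (Classical.arbitrary A)).1.trans (le_maxQ Q s _), maxQ_le fun a => (h s a).2⟩
  have h1 := hmax s
  have h2 := hmax (y s a)
  cases η <;> simp only [empBellman] <;> constructor <;> linarith [h1.1, h1.2, h2.1, h2.2]

lemma iterate_mem_Icc (M : AMDP S A) (η : Variant) {lam : ℝ} (h0 : 0 ≤ lam) (h1 : lam ≤ 1)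
    (y : ℕ → S → A → S) (t : ℕ) (s : S) (a : A) :
    M.iterate η lam y t s a ∈ Set.Icc 0 (lam * t) := by
  induction t generalizing s a with
  | zero => simp [iterate]
  | succ t ih =>
    have h2 := M.empBellman_mem_Icc η ih (y (t + 1)) s a
    have h3 := ih s a
    have h4 := M.r_nonneg s a
    have h5 := M.r_le_one s a
    rw [iterate]
    push_cast
    constructor
    · have := mul_nonneg (sub_nonneg.2 h1) h3.1
      have := mul_nonneg h0 (h4.trans h2.1)
      linarith
    · have h6 := mul_le_mul_of_nonneg_left h3.2 (sub_nonneg.2 h1)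
      have h7 : M.empBellman η (y (t + 1)) (M.iterate η lam y t) s a ≤ 1 + lam * t := by
        linarith [h2.2]
      have := mul_le_mul_of_nonneg_left h7 h0
      linarith

lemma iterate_congr (M : AMDP S A) (η : Variant) (lam : ℝ) {y y' : ℕ → S → A → S} {t : ℕ}
    (h : ∀ i, 1 ≤ i → i ≤ t → y i = y' i) : M.iterate η lam y t = M.iterate η lam y' t := by
  induction t with
  | zero => rfl
  | succ t ih =>
    funext s a
    rw [iterate, iterate, ih fun i h1 h2 => h i h1 (by omega), h (t + 1) (by omega) le_rfl]

lemma noise_congr (M : AMDP S A) (η : Variant) (lam : ℝ) {y y' : ℕ → S → A → S} {t : ℕ}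
    (h : ∀ i, 1 ≤ i → i ≤ t → y i = y' i) : M.noise η lam y t = M.noise η lam y' t := by
  induction t with
  | zero => rfl
  | succ t ih =>
    funext s a
    rw [noise, noise, ih fun i h1 h2 => h i h1 (by omega), h (t + 1) (by omega) le_rfl,
      M.iterate_congr η lam fun i h1 h2 => h i h1 (by omega)]

variable [Nonempty S]

lemma span_corrected_sub_le (Q Q' : S → A → ℝ) :
    span (fun s a => corrected Q s a - corrected Q' s a) ≤ 3 / 2 * span (Q - Q') := by
  obtain ⟨m, hm⟩ := exists_mem_Icc_span (Q - Q')
  have h : ∀ s a, corrected Q s a - corrected Q' s a ∈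
      Set.Icc (m - 1 / 2 * (m + span (Q - Q'))) (m + span (Q - Q') - 1 / 2 * m) := by
    intro s a
    have h1 := maxQ_sub_mem_Icc fun a => hm s a
    have h2 := hm s a
    simp only [Pi.sub_apply] at h2
    simp only [corrected]
    constructor <;> linarith [h1.1, h1.2, h2.1, h2.2]
  have := span_le_of_mem_Icc h
  linarith

lemma span_le_two_mul {Q : S → A → ℝ} {c : ℝ} (h : ∀ s a, |Q s a| ≤ c) : span Q ≤ 2 * c := by
  have := span_le_of_mem_Icc fun s a => abs_le.1 (h s a)
  linarith

section Contracting

variable {M : AMDP S A} {N : Seminorm ℝ (S → A → ℝ)} {κ : ℝ}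

lemma seminorm_lazy_solution_le (hκ : 0 < κ) (hN2 : ∀ Q, N Q ≤ 2 * span Q)
    (hc : ∀ Q Q', N (M.lazyBellman Q - M.lazyBellman Q') ≤ (1 - 1 / (2 * κ)) * N (Q - Q'))
    {Q : S → A → ℝ} {g : ℝ} (hQ : ∀ s a, M.lazyBellman Q s a = Q s a + g) : N Q ≤ 4 * κ := by
  have e : Q = (M.lazyBellman Q - M.lazyBellman 0) + M.lazyBellman 0 - fun _ _ => g := by
    funext s a
    simp [hQ]
  have h1 : N Q ≤ N (M.lazyBellman Q - M.lazyBellman 0) + N (M.lazyBellman 0) := by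
    conv_lhs => rw [e]
    refine (map_sub_le_add N _ _).trans ?_
    rw [seminorm_const hN2, add_zero]
    exact map_add_le_add N _ _
  have h2 := hc Q 0
  rw [sub_zero] at h2
  have h3 : N (M.lazyBellman 0) ≤ 2 := by
    have hmax : ∀ s, maxQ (0 : S → A → ℝ) s = 0 := fun s =>
      le_antisymm (maxQ_le fun _ => le_rfl) (le_maxQ 0 s (Classical.arbitrary A))
    have : span (M.lazyBellman 0) ≤ 1 - 0 := span_le_of_mem_Icc fun s a => by
      simp only [lazyBellman, lazyStep_apply, hmax, mul_zero, Finset.sum_const_zero, add_zero]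
      exact ⟨M.r_nonneg s a, M.r_le_one s a⟩
    linarith [hN2 (M.lazyBellman 0)]
  have h4 : 1 / (2 * κ) * N Q ≤ 2 := by linarith
  rw [one_div, inv_mul_le_iff₀ (by positivity)] at h4
  linarith

/-- The error of the iterates after subtraction of the noise obeys a contracting recursion whose
driving term is the size of the noise. -/
lemma seminorm_error_le (η : Variant) (hκ : 1 ≤ κ) (hN2 : ∀ Q, N Q ≤ 2 * span Q)
    (hc : ∀ Q Q', N (M.lazyBellman Q - M.lazyBellman Q') ≤ (1 - 1 / (2 * κ)) * N (Q - Q'))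
    {Q : S → A → ℝ} {g : ℝ} (hQ : ∀ s a, M.lazyBellman Q s a = Q s a + g)
    {lam : ℝ} (h0 : 0 ≤ lam) (h1 : lam ≤ 1) (y : ℕ → S → A → S) {u : ℝ} {T : ℕ}
    (hu : ∀ t ≤ T, ∀ s a, |M.noise η lam y t s a| ≤ u) :
    N (M.iterate η lam y T - Q - M.noise η lam y T) ≤
      (1 - lam / (2 * κ)) ^ T * (4 * κ) + 8 * κ * u := by
  have hu0 : 0 ≤ u := (abs_nonneg _).trans
    (hu 0 (Nat.zero_le _) (Classical.arbitrary S) (Classical.arbitrary A))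
  have hb : 1 / (2 * κ) ≤ 1 := by
    rw [div_le_one (by positivity)]
    linarith
  have hb0 : 0 < 1 / (2 * κ) := by positivity
  induction T with
  | zero =>
    have e : M.iterate η lam y 0 - Q - M.noise η lam y 0 = -Q := by
      funext s a
      simp [iterate, noise]
    rw [e, map_neg_eq_map, pow_zero, one_mul]
    have := seminorm_lazy_solution_le (by linarith) hN2 hc hQ
    have : 0 ≤ 8 * κ * u := by positivity
    linarith
  | succ T ih =>
    have ih := ih fun t ht => hu t (by omega)
    set X := M.iterate η lam y T - Q - M.noise η lam y T with hX
    have e : M.iterate η lam y (T + 1) - Q - M.noise η lam y (T + 1) =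
        (1 - lam) • X + lam • (M.lazyBellman (M.iterate η lam y T) - M.lazyBellman Q) +
          fun _ _ => lam * g := by
      funext s a
      simp only [hX, iterate, noise, Pi.add_apply, Pi.sub_apply, Pi.smul_apply, smul_eq_mul, hQ]
      ring
    have h2 : N (M.iterate η lam y T - Q) ≤ N X + 4 * u := by
      have : M.iterate η lam y T - Q = X + M.noise η lam y T := by
        rw [hX]
        abel
      rw [this]
      refine (map_add_le_add N _ _).trans ?_
      have := hN2 (M.noise η lam y T)
      have := span_le_two_mul (hu T (by omega))
      linarith
    have h3 : N ((1 - lam) • X + lam • (M.lazyBellman (M.iterate η lam y T) - M.lazyBellman Q) +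
        fun _ _ => lam * g) ≤ (1 - lam) * N X + lam * ((1 - 1 / (2 * κ)) * (N X + 4 * u)) := by
      refine (map_add_le_add N _ _).trans ?_
      rw [seminorm_const hN2, add_zero]
      refine (map_add_le_add N _ _).trans ?_
      rw [map_smul_eq_mul, map_smul_eq_mul, Real.norm_of_nonneg (sub_nonneg.2 h1),
        Real.norm_of_nonneg h0]
      gcongr
      exact (hc _ _).trans (mul_le_mul_of_nonneg_left h2 (by linarith))
    rw [e]
    refine h3.trans ?_
    have h4 : (1 - lam) * N X + lam * ((1 - 1 / (2 * κ)) * (N X + 4 * u)) ≤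
        (1 - lam / (2 * κ)) * N X + lam * (4 * u) := by
      have : 0 ≤ lam * (1 / (2 * κ) * (4 * u)) := by positivity
      have e2 : lam / (2 * κ) = lam * (1 / (2 * κ)) := by ring
      rw [e2]
      linarith
    refine h4.trans ?_
    have h5 : 0 ≤ 1 - lam / (2 * κ) := by
      have : lam * (1 / (2 * κ)) ≤ 1 * 1 := mul_le_mul h1 hb hb0.le zero_le_one
      have e2 : lam / (2 * κ) = lam * (1 / (2 * κ)) := by ring
      rw [e2]
      linarith
    have h6 := mul_le_mul_of_nonneg_left ih h5
    have e3 : (1 - lam / (2 * κ)) * (8 * κ * u) = 8 * κ * u - lam * (4 * u) := by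
      field_simp
      ring
    rw [pow_succ']
    linarith

lemma span_corrected_error_le (η : Variant) (hκ : 1 ≤ κ) (hN : ∀ Q, span Q ≤ N Q)
    (hN2 : ∀ Q, N Q ≤ 2 * span Q)
    (hc : ∀ Q Q', N (M.lazyBellman Q - M.lazyBellman Q') ≤ (1 - 1 / (2 * κ)) * N (Q - Q'))
    {QStar : S → A → ℝ} {g : ℝ} (hQ : M.IsOptimalQ g QStar)
    {lam : ℝ} (h0 : 0 ≤ lam) (h1 : lam ≤ 1) (y : ℕ → S → A → S) {u : ℝ} {T : ℕ}
    (hu : ∀ t ≤ T, ∀ s a, |M.noise η lam y t s a| ≤ u) :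
    span (fun s a => corrected (M.iterate η lam y T) s a - QStar s a) ≤
      6 * κ * (1 - lam / (2 * κ)) ^ T + 15 * κ * u := by
  obtain ⟨Q, hQl, rfl⟩ := M.exists_lazy_of_isOptimalQ hQ
  have h2 := span_corrected_sub_le (M.iterate η lam y T) Q
  have h3 := seminorm_error_le η hκ hN2 hc hQl h0 h1 y hu
  have h4 : span (M.iterate η lam y T - Q) ≤
      span (M.iterate η lam y T - Q - M.noise η lam y T) + span (M.noise η lam y T) := by
    have := map_add_le_add (spanSeminorm S A) (M.iterate η lam y T - Q - M.noise η lam y T)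
      (M.noise η lam y T)
    rwa [sub_add_cancel] at this
  have h5 := hN (M.iterate η lam y T - Q - M.noise η lam y T)
  have h6 := span_le_two_mul (hu T le_rfl)
  have h7 : u ≤ κ * u := by
    have : 0 ≤ u := (abs_nonneg _).trans
      (hu 0 (Nat.zero_le _) (Classical.arbitrary S) (Classical.arbitrary A))
    nlinarith
  linarith

end Contracting

end Iteration

/-! ### Concentration of the noise -/

section Concentration

section History

variable {S : Type u} {A : Type v} [Fintype S] [DecidableEq S]

lemma sum_lazyP_mul (M : AMDP S A) (s : S) (a : A) (f : S → ℝ) :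
    ∑ s', M.lazyP s a s' * f s' = M.lazyStep f s a := by
  have : ∀ s', M.lazyP s a s' * f s' =
      (if s' = s then 1 / 2 * f s' else 0) + 1 / 2 * (M.p s a s' * f s') := by
    intro s'
    rw [lazyP]
    split_ifs with h
    · rw [h]
      ring
    · ring
  simp_rw [this]
  rw [Finset.sum_add_distrib, Finset.sum_ite_eq' Finset.univ s, if_pos (Finset.mem_univ s),
    ← Finset.mul_sum, lazyStep_apply]

variable [Fintype A] [MeasurableSpace S] {M : AMDP S A} {η : Variant} {T : ℕ} {Ω : Type w}
  [MeasurableSpace Ω] {X : ℕ → S → A → Ω → S} {μ : Measure Ω}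

/-- The samples of the first `t` iterations are a measurable function into a finite type, which is
independent of each sample of iteration `t + 1`. -/
lemma exists_history [IsProbabilityMeasure μ] (hX : M.IsSampling η T X μ) {t : ℕ} (ht : t < T)
    (s : S) (a : A) :
    ∃ (I : Finset (Finset.Icc 1 T × S × A)) (H : Ω → (I → S)) (dec : (I → S) → ℕ → S → A → S),
      Measurable H ∧ IndepFun H (X (t + 1) s a) μ ∧
        ∀ ω i, 1 ≤ i → i ≤ t → dec (H ω) i = fun s a => X i s a ω := by
  classical
  set I : Finset (Finset.Icc 1 T × S × A) := Finset.univ.filter fun i => (i.1 : ℕ) ≤ t with hI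
  have hmeas : ∀ i : Finset.Icc 1 T × S × A, Measurable (X i.1 i.2.1 i.2.2) :=
    fun i => hX.measurable _ i.1.2 _ _
  have ht1 : t + 1 ∈ Finset.Icc 1 T := Finset.mem_Icc.2 ⟨by omega, ht⟩
  set j : Finset.Icc 1 T × S × A := (⟨t + 1, ht1⟩, s, a) with hj
  have hdisj : Disjoint I {j} := by
    rw [Finset.disjoint_singleton_right, hI, Finset.mem_filter]
    simp [hj]
  have hind := iIndepFun.indepFun_finset I {j} hdisj hX.indep hmeas
  refine ⟨I, fun ω i => X i.1.1 i.1.2.1 i.1.2.2 ω,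
    fun h i s a => if hi : ∃ hT : i ∈ Finset.Icc 1 T, ((⟨i, hT⟩, s, a) : Finset.Icc 1 T × S × A) ∈ I
      then h ⟨_, hi.2⟩ else s, ?_, ?_, ?_⟩
  · exact measurable_pi_lambda _ fun i => hmeas i.1
  · exact hind.comp measurable_id
      (measurable_pi_apply (⟨j, Finset.mem_singleton_self j⟩ : ({j} : Finset _)))
  · intro ω i h1 h2
    funext s a
    have hT : i ∈ Finset.Icc 1 T := Finset.mem_Icc.2 ⟨h1, by omega⟩
    have hi : ∃ hT : i ∈ Finset.Icc 1 T, ((⟨i, hT⟩, s, a) : Finset.Icc 1 T × S × A) ∈ I :=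
      ⟨hT, by simp [hI, h2]⟩
    simp only
    rw [dif_pos hi]

end History

variable {S : Type u} {A : Type v} [Fintype S] [DecidableEq S] [Fintype A] [Nonempty A]

/-- Both variants estimate the lazy Bellman operator without bias. -/
lemma sum_sampleLaw_mul_empBellman (M : AMDP S A) (η : Variant) (Q : S → A → ℝ) (s : S) (a : A) :
    ∑ s', M.sampleLaw η s a s' * M.empBellman η (fun _ _ => s') Q s a = M.lazyBellman Q s a := by
  cases η
  · simp only [sampleLaw, empBellman]
    rw [M.sum_lazyP_mul, lazyBellman, lazyStep_apply, lazyStep_apply]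
    simp only [mul_add, Finset.sum_add_distrib]
    rw [← Finset.sum_mul, M.p_sum]
    ring
  · simp only [sampleLaw, empBellman, mul_add, Finset.sum_add_distrib]
    rw [← Finset.sum_mul, ← Finset.sum_mul, M.p_sum, lazyBellman, lazyStep_apply, Finset.mul_sum]
    have : ∀ s', M.p s a s' * (1 / 2 * maxQ Q s') = 1 / 2 * (M.p s a s' * maxQ Q s') :=
      fun s' => by ring
    simp_rw [this]
    ring

variable [MeasurableSpace S] [MeasurableSingletonClass S]

/-- Hoeffding's lemma for one sampling error. -/
lemma integral_exp_empBellman_le (M : AMDP S A) (η : Variant) {Q : S → A → ℝ} {b : ℝ}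
    (hQ : ∀ s a, Q s a ∈ Set.Icc 0 b) (s : S) (a : A) (ν : Measure S) [IsProbabilityMeasure ν]
    (hν : ∀ s', ν.real {s'} = M.sampleLaw η s a s') (θ : ℝ) :
    ∫ s', Real.exp (θ * (M.empBellman η (fun _ _ => s') Q s a - M.lazyBellman Q s a)) ∂ν ≤
      Real.exp ((b / 2) ^ 2 * θ ^ 2 / 2) := by
  have hmean : ∫ s', M.empBellman η (fun _ _ => s') Q s a ∂ν = M.lazyBellman Q s a := by
    rw [integral_fintype Integrable.of_finite, ← M.sum_sampleLaw_mul_empBellman η]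
    simp_rw [hν, smul_eq_mul]
  have h := (hasSubgaussianMGF_of_mem_Icc (μ := ν)
    (X := fun s' => M.empBellman η (fun _ _ => s') Q s a)
    (Measurable.of_discrete.aemeasurable)
    (ae_of_all _ fun s' => M.empBellman_mem_Icc η hQ (fun _ _ => s') s a)).mgf_le θ
  rw [hmean, mgf] at h
  simpa [sq_abs, div_pow] using h

section Sampling

variable {M : AMDP S A} {η : Variant} {T : ℕ} {Ω : Type w} [MeasurableSpace Ω]
  {X : ℕ → S → A → Ω → S} {μ : Measure Ω}

lemma hasSubgaussianMGF_noise [IsProbabilityMeasure μ] (hX : M.IsSampling η T X μ) {lam R : ℝ}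
    (h0 : 0 ≤ lam) (h1 : lam ≤ 1) (hR : lam * T ≤ R) {t : ℕ} (ht : t ≤ T) (s : S) (a : A) :
    HasSubgaussianMGF (fun ω => M.noise η lam (fun t s a => X t s a ω) t s a)
      (Real.toNNReal (lam * (R / 2) ^ 2)) μ := by
  induction t generalizing s a with
  | zero =>
    have : (fun ω => M.noise η lam (fun t s a => X t s a ω) 0 s a) = fun _ => 0 := rfl
    rw [this]
    refine ⟨fun θ => by simp, fun θ => ?_⟩
    simp [mgf, Real.one_le_exp_iff]
    positivity
  | succ t ih =>
    have ht' : t < T := ht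
    obtain ⟨I, H, dec, hH, hind, hdec⟩ := exists_history hX ht' s a
    set G : (I → S) → ℝ := fun h => M.noise η lam (dec h) t s a with hG
    set Qh : (I → S) → S → A → ℝ := fun h => M.iterate η lam (dec h) t with hQh
    set F : (I → S) → S → ℝ := fun h y =>
      M.empBellman η (fun _ _ => y) (Qh h) s a - M.lazyBellman (Qh h) s a with hF
    have hXm : Measurable (X (t + 1) s a) :=
      hX.measurable _ (Finset.mem_Icc.2 ⟨by omega, ht⟩) s a
    have hnoise : ∀ ω, M.noise η lam (fun t s a => X t s a ω) (t + 1) s a =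
        (1 - lam) * G (H ω) + lam * F (H ω) (X (t + 1) s a ω) := by
      intro ω
      rw [noise, M.noise_congr η lam fun i h1 h2 => (hdec ω i h1 h2).symm,
        M.iterate_congr η lam fun i h1 h2 => (hdec ω i h1 h2).symm]
      simp only [hG, hF, hQh]
      cases η <;> rfl
    have hpair : Measurable fun ω => (H ω, X (t + 1) s a ω) := hH.prodMk hXm
    have hμX : IsProbabilityMeasure (μ.map (X (t + 1) s a)) :=
      Measure.isProbabilityMeasure_map hXm.aemeasurable
    have hμH : IsProbabilityMeasure (μ.map H) := Measure.isProbabilityMeasure_map hH.aemeasurable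
    have hlaw : ∀ s', (μ.map (X (t + 1) s a)).real {s'} = M.sampleLaw η s a s' := by
      intro s'
      rw [map_measureReal_apply hXm (measurableSet_singleton s')]
      exact hX.law (t + 1) (Finset.mem_Icc.2 ⟨by omega, ht⟩) s a s'
    refine ⟨fun θ => ?_, fun θ => ?_⟩
    · simp_rw [hnoise]
      exact (Integrable.of_finite (μ := μ.map fun ω => (H ω, X (t + 1) s a ω)) (f := fun z =>
        Real.exp (θ * ((1 - lam) * G z.1 + lam * F z.1 z.2)))).comp_measurable hpair
    · have hR0 : 0 ≤ R := le_trans (by positivity) hR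
      have hQ : ∀ h s a, Qh h s a ∈ Set.Icc 0 R := by
        intro h s a
        have h2 := M.iterate_mem_Icc η h0 h1 (dec h) t s a
        refine ⟨h2.1, h2.2.trans (le_trans ?_ hR)⟩
        gcongr
      have key : ∫ ω, Real.exp (θ * ((1 - lam) * G (H ω) + lam * F (H ω) (X (t + 1) s a ω))) ∂μ ≤
          (∫ ω, Real.exp (θ * (1 - lam) * G (H ω)) ∂μ) *
            Real.exp ((R / 2) ^ 2 * (θ * lam) ^ 2 / 2) := by
        calc _ = ∫ z, Real.exp (θ * ((1 - lam) * G z.1 + lam * F z.1 z.2))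
              ∂(μ.map fun ω => (H ω, X (t + 1) s a ω)) := by
              rw [integral_map hpair.aemeasurable Measurable.of_discrete.aestronglyMeasurable]
          _ = ∫ h, ∫ y, Real.exp (θ * ((1 - lam) * G h + lam * F h y)) ∂(μ.map (X (t + 1) s a))
              ∂(μ.map H) := by
              rw [(indepFun_iff_map_prod_eq_prod_map_map hH.aemeasurable hXm.aemeasurable).1 hind,
                integral_prod _ Integrable.of_finite]
          _ ≤ ∫ h, Real.exp (θ * (1 - lam) * G h) * Real.exp ((R / 2) ^ 2 * (θ * lam) ^ 2 / 2)
              ∂(μ.map H) := by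
              refine integral_mono Integrable.of_finite Integrable.of_finite fun h => ?_
              have e : ∀ y, Real.exp (θ * ((1 - lam) * G h + lam * F h y)) =
                  Real.exp (θ * (1 - lam) * G h) * Real.exp ((θ * lam) * F h y) := fun y => by
                rw [← Real.exp_add]
                congr 1
                ring
              simp only
              simp_rw [e]
              rw [integral_const_mul]
              exact mul_le_mul_of_nonneg_left
                (M.integral_exp_empBellman_le η (hQ h) s a _ hlaw (θ * lam)) (Real.exp_nonneg _)
          _ = _ := by
              rw [integral_mul_const,
                integral_map hH.aemeasurable Measurable.of_discrete.aestronglyMeasurable]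
      have hih := (ih ht'.le s a).mgf_le (θ * (1 - lam))
      have hnoise' : ∀ ω, M.noise η lam (fun t s a => X t s a ω) t s a = G (H ω) := fun ω => by
        rw [M.noise_congr η lam fun i h1 h2 => (hdec ω i h1 h2).symm]
      have hc0 : 0 ≤ lam * (R / 2) ^ 2 := by positivity
      rw [Real.coe_toNNReal _ hc0] at hih ⊢
      simp_rw [mgf, hnoise'] at hih
      simp_rw [mgf, hnoise]
      refine key.trans ((mul_le_mul_of_nonneg_right hih (Real.exp_nonneg _)).trans ?_)
      rw [← Real.exp_add, Real.exp_le_exp]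
      have h2 : 0 ≤ (R / 2) ^ 2 * θ ^ 2 / 2 := by positivity
      have h3 : lam * (1 - lam) ^ 2 + lam ^ 2 ≤ lam := by
        nlinarith [mul_nonneg (mul_nonneg h0 h0) (sub_nonneg.2 h1)]
      have := mul_le_mul_of_nonneg_left h3 h2
      linarith

/-- Union bound over the run: if `u` is at least `R √(λ log (2 |S| |A| T / ξ) / 2)`, then the noise
exceeds `u` somewhere with probability at most `ξ`. -/
lemma measure_noise_gt_le [IsProbabilityMeasure μ] (hX : M.IsSampling η T X μ) {lam R u ξ : ℝ}
    (h0 : 0 < lam) (h1 : lam ≤ 1) (hR : lam * T ≤ R) (hR0 : 0 < R) (hu : 0 ≤ u) (hξ : 0 < ξ)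
    [Nonempty S] (hT : 0 < T)
    (hu2 : lam * R ^ 2 * Real.log (2 * (Fintype.card S * Fintype.card A * T) / ξ) ≤ 2 * u ^ 2) :
    μ.real {ω | ¬ ∀ t ≤ T, ∀ s a, |M.noise η lam (fun t s a => X t s a ω) t s a| ≤ u} ≤ ξ := by
  set c : ℝ := Fintype.card S * Fintype.card A * T with hc
  have hS : (0 : ℝ) < Fintype.card S := by exact_mod_cast Fintype.card_pos
  have hA : (0 : ℝ) < Fintype.card A := by exact_mod_cast Fintype.card_pos
  have hT' : (0 : ℝ) < T := by exact_mod_cast hT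
  have hc0 : 0 < c := by positivity
  set W : ℕ → S → A → Ω → ℝ := fun t s a ω => M.noise η lam (fun t s a => X t s a ω) t s a with hW
  have hexp : Real.exp (-u ^ 2 / (2 * (lam * (R / 2) ^ 2))) ≤ ξ / (2 * c) := by
    rw [← Real.le_log_iff_exp_le (by positivity), ← inv_div (2 * c), Real.log_inv, neg_div,
      neg_le_neg_iff, le_div_iff₀ (by positivity)]
    linarith
  have htail : ∀ t ≤ T, ∀ s a, μ.real {ω | u ≤ |W t s a ω|} ≤ ξ / c := by
    intro t ht s a
    have h2 := hasSubgaussianMGF_noise hX h0.le h1 hR ht s a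
    have h3 := h2.measure_ge_le hu
    have h4 := h2.neg.measure_ge_le hu
    rw [Real.coe_toNNReal _ (by positivity)] at h3 h4
    have hsub : {ω | u ≤ |W t s a ω|} ⊆ {ω | u ≤ W t s a ω} ∪ {ω | u ≤ (-W t s a) ω} := by
      intro ω hω
      rcases le_abs.1 (show u ≤ |W t s a ω| from hω) with h | h
      · exact Or.inl h
      · exact Or.inr h
    calc _ ≤ _ := measureReal_mono hsub
      _ ≤ _ := measureReal_union_le _ _
      _ ≤ ξ / (2 * c) + ξ / (2 * c) := add_le_add (h3.trans hexp) (h4.trans hexp)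
      _ = ξ / c := by
        field_simp
        ring
  have hsub : {ω | ¬ ∀ t ≤ T, ∀ s a, |W t s a ω| ≤ u} ⊆
      ⋃ z ∈ (Finset.Icc 1 T ×ˢ (Finset.univ : Finset (S × A))),
        {ω | u ≤ |W z.1 z.2.1 z.2.2 ω|} := by
    intro ω hω
    have hω : ¬ ∀ t ≤ T, ∀ s a, |W t s a ω| ≤ u := hω
    push Not at hω
    obtain ⟨t, ht, s, a, hlt⟩ := hω
    have ht1 : 1 ≤ t := by
      by_contra! h
      obtain rfl : t = 0 := by omega
      have : W 0 s a ω = 0 := rfl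
      rw [this, abs_zero] at hlt
      linarith
    refine Set.mem_biUnion (x := (t, s, a)) ?_ hlt.le
    simp [ht, ht1]
  refine (measureReal_mono hsub (measure_ne_top _ _)).trans
    ((measureReal_biUnion_finset_le _ _).trans ?_)
  calc _ ≤ ∑ z ∈ (Finset.Icc 1 T ×ˢ (Finset.univ : Finset (S × A))), ξ / c :=
        Finset.sum_le_sum fun z hz => htail _ (by simp at hz; exact hz.2) _ _
    _ = ξ := by
        rw [Finset.sum_const, Finset.card_product, Nat.card_Icc, Finset.card_univ,
          Fintype.card_prod, nsmul_eq_mul]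
        push_cast
        rw [hc]
        field_simp

end Sampling

end Concentration

/-! ### Stepsize and sample complexity -/

/-- The polynomial factor `(K (K + 1))⁵` is absorbed by the gap between `2 ^ (5 K)` and
`2 ^ (6 K)`. -/
lemma contrConst_pow_le {K : ℝ} (hK : 1 ≤ K) :
    contrConst K ^ 5 ≤ 2 ^ 15 * (Nat.factorial 10 : ℝ) * (2 : ℝ) ^ (6 * K) := by
  have h1 : (2 : ℝ) ^ (6 * K) = ((2 : ℝ) ^ K) ^ 5 * (2 : ℝ) ^ K := by
    rw [← pow_succ, ← Real.rpow_mul_natCast zero_le_two]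
    congr 1
    push_cast
    ring
  have hlog : (1 / 2 : ℝ) ≤ Real.log 2 := by linarith [Real.log_two_gt_d9]
  have h2 : (K / 2) ^ 10 / (Nat.factorial 10 : ℝ) ≤ (2 : ℝ) ^ K := by
    have := Real.pow_div_factorial_le_exp (x := Real.log 2 * K) (by positivity) 10
    rw [Real.rpow_def_of_pos two_pos]
    refine le_trans ?_ this
    have hhalf : K / 2 ≤ Real.log 2 * K := by nlinarith
    gcongr
  have h3 : (K * (K + 1)) ^ 5 ≤ 2 ^ 15 * (Nat.factorial 10 : ℝ) * (2 : ℝ) ^ K := by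
    have h4 : (K * (K + 1)) ^ 5 ≤ (2 * K ^ 2) ^ 5 :=
      pow_le_pow_left₀ (by positivity) (by nlinarith) 5
    rw [div_le_iff₀ (by positivity)] at h2
    calc _ ≤ _ := h4
      _ = 2 ^ 15 * (K / 2) ^ 10 := by ring
      _ ≤ _ := by linarith
  rw [contrConst, mul_pow, h1]
  have : (0 : ℝ) ≤ ((2 : ℝ) ^ K) ^ 5 := by positivity
  nlinarith [mul_le_mul_of_nonneg_right h3 this]

/-- The universal constant in the condition on the number of iterations. -/
noncomputable def iterConst : ℝ := 441 * (2 ^ 15 * (Nat.factorial 10 : ℝ))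

lemma iterConst_pos : 0 < iterConst := by
  unfold iterConst
  positivity

/-- The numerical heart of the guarantee. All terms of the error bound are at most multiples of
`(κ⁵ log³ T · L / T)^(1/2)` with `κ = K (K + 1) 2 ^ K`: the initial error is damped to `κ T^(-1/2)`
if the stepsize is not truncated, and if it is, then `T < κ log T` makes `ε` exceed the initial
error. -/
lemma error_bound_le {K ε L : ℝ} {T : ℕ} (hK : 1 ≤ K) (hε : 0 < ε) (hT : 2 ≤ T)
    (hL : Real.log 2 ≤ L)
    (h : iterConst * ((2 : ℝ) ^ (6 * K) * Real.log T ^ 3 / ε ^ 2) * L ≤ T) :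
    6 * contrConst K * (1 - stepsize K T / (2 * contrConst K)) ^ T
      + 15 * contrConst K * √(contrConst K ^ 3 * Real.log T ^ 3 * L / T) ≤ ε := by
  have hκ := four_le_contrConst hK
  have hκ5 := contrConst_pow_le hK
  set κ := contrConst K with hκdef
  have hstep : stepsize K T = min 1 (κ * Real.log T / T) := rfl
  have hT' : (2 : ℝ) ≤ T := by exact_mod_cast hT
  have hlog2 : (0.69 : ℝ) ≤ Real.log 2 := by linarith [Real.log_two_gt_d9]
  have hlogT : (0.69 : ℝ) ≤ Real.log T := hlog2.trans (Real.log_le_log two_pos hT')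
  have hL0 : (0.69 : ℝ) ≤ L := hlog2.trans hL
  set ℓ := Real.log T with hℓ
  set Y := κ ^ 5 * ℓ ^ 3 * L / T with hY
  have hYε : Y ≤ (ε / 21) ^ 2 := by
    rw [hY, div_le_iff₀ (by positivity)]
    have h1 : iterConst * (2 : ℝ) ^ (6 * K) * ℓ ^ 3 * L ≤ T * ε ^ 2 := by
      have := mul_le_mul_of_nonneg_right h (by positivity : 0 ≤ ε ^ 2)
      refine le_trans (le_of_eq ?_) this
      field_simp
    have h2 : 441 * κ ^ 5 ≤ iterConst * (2 : ℝ) ^ (6 * K) := by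
      unfold iterConst
      linarith
    have h3 := mul_le_mul_of_nonneg_right h2 (by positivity : 0 ≤ ℓ ^ 3 * L)
    linarith
  have hκ1 : κ * √(κ ^ 3 * ℓ ^ 3 * L / T) ≤ ε / 21 := by
    rw [← sq_le_sq₀ (by positivity) (by positivity), mul_pow, Real.sq_sqrt (by positivity)]
    refine le_trans (le_of_eq ?_) hYε
    rw [hY]
    ring
  set lam := stepsize K T with hlam
  have hlam0 : 0 ≤ lam := by
    rw [hstep]
    exact le_min zero_le_one (by positivity)
  have hlam1 : lam ≤ 1 := by
    rw [hstep]
    exact min_le_left _ _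
  have hq0 : 0 ≤ 1 - lam / (2 * κ) := by
    rw [sub_nonneg, div_le_one (by positivity)]
    linarith
  have hκ2 : κ * (1 - lam / (2 * κ)) ^ T ≤ ε / 21 := by
    rw [← sq_le_sq₀ (by positivity) (by positivity)]
    refine le_trans ?_ hYε
    have hl3 : (0.3 : ℝ) ≤ ℓ ^ 3 := by
      calc (0.3 : ℝ) ≤ 0.69 ^ 3 := by norm_num
        _ ≤ ℓ ^ 3 := by gcongr
    rcases le_total 1 (κ * ℓ / T) with hc | hc
    · have h1 : (1 - lam / (2 * κ)) ^ T ≤ 1 := by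
        refine pow_le_one₀ hq0 ?_
        have : 0 ≤ lam / (2 * κ) := by positivity
        linarith
      have h2 : (κ * (1 - lam / (2 * κ)) ^ T) ^ 2 ≤ κ ^ 2 := by
        gcongr
        exact mul_le_of_le_one_right (by linarith) h1
      have h3 : κ ^ 2 ≤ κ ^ 4 * (ℓ ^ 2 * L) := by
        have h4 : (0.3 : ℝ) ≤ ℓ ^ 2 * L := by
          calc (0.3 : ℝ) ≤ 0.69 ^ 2 * 0.69 := by norm_num
            _ ≤ ℓ ^ 2 * L := by gcongr
        have h5 : (4 : ℝ) ^ 2 ≤ κ ^ 2 := by gcongr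
        have h6 : 1 ≤ κ ^ 2 * (ℓ ^ 2 * L) := by nlinarith
        calc κ ^ 2 ≤ κ ^ 2 * (κ ^ 2 * (ℓ ^ 2 * L)) := le_mul_of_one_le_right (by positivity) h6
          _ = _ := by ring
      have h4 : κ ^ 4 * (ℓ ^ 2 * L) ≤ Y := by
        calc κ ^ 4 * (ℓ ^ 2 * L) ≤ κ ^ 4 * (ℓ ^ 2 * L) * (κ * ℓ / T) :=
              le_mul_of_one_le_right (by positivity) hc
          _ = Y := by
            rw [hY]
            ring
      linarith
    · have hlamT : lam = κ * ℓ / T := by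
        rw [hstep]
        exact min_eq_right hc
      have h1 : ((1 - lam / (2 * κ)) ^ T) ^ 2 ≤ 1 / T := by
        calc ((1 - lam / (2 * κ)) ^ T) ^ 2 ≤ (Real.exp (-(lam / (2 * κ))) ^ T) ^ 2 := by
              gcongr
              exact Real.one_sub_le_exp_neg _
          _ = Real.exp (-ℓ) := by
              rw [← Real.exp_nat_mul, ← Real.exp_nat_mul, hlamT]
              congr 1
              push_cast
              field_simp
          _ = 1 / T := by
              rw [Real.exp_neg, hℓ, Real.exp_log (by linarith), one_div]
      rw [mul_pow]
      calc κ ^ 2 * ((1 - lam / (2 * κ)) ^ T) ^ 2 ≤ κ ^ 2 * (1 / T) := by gcongr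
        _ ≤ κ ^ 2 * (κ ^ 3 * (ℓ ^ 3 * L)) / T := by
            rw [mul_one_div]
            gcongr
            refine le_mul_of_one_le_right (by positivity) ?_
            have h3 : (4 : ℝ) ^ 3 ≤ κ ^ 3 := by gcongr
            have h4 : (0.2 : ℝ) ≤ ℓ ^ 3 * L := by
              calc (0.2 : ℝ) ≤ 0.3 * 0.69 := by norm_num
                _ ≤ ℓ ^ 3 * L := by gcongr
            nlinarith
        _ = Y := by
            rw [hY]
            ring
  linarith

/-- The condition on the number of iterations, in which `T` occurs on both sides through logarithms,
is met by some `T` of order `2 ^ (6 K) ε⁻² (K + log (n / (ε ξ)))⁴`. -/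
lemma exists_iterations {C₀ : ℝ} (hC₀ : 0 < C₀) :
    ∃ C₁ : ℝ, 0 < C₁ ∧ ∀ K n ε ξ : ℝ, 1 ≤ K → 1 ≤ n → 0 < ε → ε ≤ 1 → 0 < ξ → ξ ≤ 1 →
      ∃ T : ℕ, 2 ≤ T ∧
        C₀ * ((2 : ℝ) ^ (6 * K) * Real.log T ^ 3 / ε ^ 2) * Real.log (n * T / ξ) ≤ T ∧
        n * T ≤ C₁ * (2 : ℝ) ^ (6 * K) * n / ε ^ 2 * (K + Real.log (n / (ε * ξ))) ^ 4 := by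
  -- `c` is the constant in `log T ≤ c (K + log (n / (ε ξ)))`; with `C₁ = 2 a` and
  -- `a = exp (c - 10) / 2`, the logarithm of `2 a` contributes `c - 10` to it
  obtain ⟨c, hc12, hc⟩ : ∃ c : ℝ, 12 ≤ c ∧ 4 * C₀ * Real.exp 10 ≤ Real.exp c / c ^ 4 :=
    ((eventually_ge_atTop 12).and ((Real.tendsto_exp_div_pow_atTop 4).eventually_ge_atTop _)).exists
  set a := Real.exp (c - 10) / 2 with ha
  have ha1 : 1 ≤ a := by
    have := Real.add_one_le_exp (c - 10)
    rw [ha, le_div_iff₀ two_pos]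
    linarith
  have hac : C₀ * (c ^ 3 * (1 + c)) ≤ a := by
    rw [le_div_iff₀ (by positivity)] at hc
    rw [ha, Real.exp_sub, div_div, le_div_iff₀ (by positivity)]
    have h1 : c ^ 3 * (1 + c) ≤ 2 * c ^ 4 := by
      have : 0 ≤ c ^ 3 := by positivity
      nlinarith
    have h2 := mul_le_mul_of_nonneg_left h1 (by positivity : 0 ≤ C₀ * (Real.exp 10 * 2))
    linarith
  refine ⟨2 * a, by linarith, fun K n ε ξ hK hn hε hε1 hξ hξ1 => ?_⟩
  have hεξ : ε * ξ ≤ 1 := by nlinarith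
  have hlogn : 0 ≤ Real.log n := Real.log_nonneg hn
  have hlogε : 0 ≤ Real.log (1 / ε) := Real.log_nonneg (by rw [le_div_iff₀ hε]; linarith)
  have hlogξ : 0 ≤ Real.log (1 / ξ) := Real.log_nonneg (by rw [le_div_iff₀ hξ]; linarith)
  have hsplit : Real.log (n / (ε * ξ)) = Real.log n + Real.log (1 / ε) + Real.log (1 / ξ) := by
    rw [Real.log_div (by positivity) (by positivity), Real.log_mul hε.ne' hξ.ne', one_div, one_div,
      Real.log_inv, Real.log_inv]
    ring
  set ℓ := K + Real.log (n / (ε * ξ)) with hℓ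
  have hℓ1 : 1 ≤ ℓ := by linarith
  have hpow1 : (2 : ℝ) ≤ (2 : ℝ) ^ (6 * K) := by
    simpa using Real.rpow_le_rpow_of_exponent_le one_le_two (show (1 : ℝ) ≤ 6 * K by linarith)
  set Y := (2 : ℝ) ^ (6 * K) * ℓ ^ 4 / ε ^ 2 with hY
  have hY2 : 2 ≤ Y := by
    rw [hY, le_div_iff₀ (by positivity)]
    have h1 : 1 ≤ ℓ ^ 4 := one_le_pow₀ hℓ1
    have h2 : ε ^ 2 ≤ 1 := pow_le_one₀ hε.le hε1
    nlinarith
  have haY : 2 ≤ a * Y := by nlinarith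
  have hT1 : a * Y ≤ (⌈a * Y⌉₊ : ℝ) := Nat.le_ceil _
  have hT2 : (⌈a * Y⌉₊ : ℝ) ≤ 2 * (a * Y) := by
    have := Nat.ceil_lt_add_one (show 0 ≤ a * Y by linarith)
    linarith
  set T := ⌈a * Y⌉₊ with hT
  have hTpos : (2 : ℝ) ≤ T := haY.trans hT1
  have hlogT : Real.log T ≤ c * ℓ := by
    have h1 : Real.log T ≤ Real.log (2 * (a * Y)) := Real.log_le_log (by linarith) hT2
    have h2 : Real.log (2 * (a * Y)) =
        (c - 10) + (6 * K * Real.log 2 + 4 * Real.log ℓ + 2 * Real.log (1 / ε)) := by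
      have e1 : 2 * (a * Y) = Real.exp (c - 10) * ((2 : ℝ) ^ (6 * K) * ℓ ^ 4 * (1 / ε) ^ 2) := by
        rw [ha, hY]
        field_simp
      rw [e1, Real.log_mul (by positivity) (by positivity), Real.log_exp,
        Real.log_mul (by positivity) (by positivity), Real.log_mul (by positivity) (by positivity),
        Real.log_rpow two_pos, Real.log_pow, Real.log_pow]
      push_cast
      ring
    have h3 : Real.log ℓ ≤ ℓ := (Real.log_le_sub_one_of_pos (by linarith)).trans (by linarith)
    have h4 : Real.log 2 ≤ 1 := by linarith [Real.log_two_lt_d9]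
    have h5 : 6 * K * Real.log 2 ≤ 6 * K := by nlinarith
    have h6 : c - 10 ≤ (c - 10) * ℓ := le_mul_of_one_le_right (by linarith) hℓ1
    linarith
  have hlogT0 : 0 ≤ Real.log T := Real.log_nonneg (by linarith)
  have hlogL : Real.log (n * T / ξ) ≤ (1 + c) * ℓ := by
    rw [Real.log_div (by positivity) hξ.ne', Real.log_mul (by positivity) (by positivity)]
    rw [one_div, Real.log_inv] at hlogξ hlogε
    rw [one_div, one_div, Real.log_inv, Real.log_inv] at hsplit
    linarith
  have hlogL0 : 0 ≤ Real.log (n * T / ξ) := by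
    refine Real.log_nonneg ?_
    rw [le_div_iff₀ hξ]
    nlinarith
  refine ⟨T, by exact_mod_cast hTpos, ?_, ?_⟩
  · calc _ ≤ C₀ * ((2 : ℝ) ^ (6 * K) * (c * ℓ) ^ 3 / ε ^ 2) * ((1 + c) * ℓ) := by gcongr
      _ = C₀ * (c ^ 3 * (1 + c)) * Y := by
        rw [hY]
        ring
      _ ≤ a * Y := by gcongr
      _ ≤ T := hT1
  · calc n * T ≤ n * (2 * (a * Y)) := by gcongr
      _ = _ := by
        rw [hY]
        ring

section Guarantee

variable {S : Type u} {A : Type v} [Fintype S] [DecidableEq S] [Fintype A] [Nonempty A] [Nonempty S]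
  [MeasurableSpace S] [MeasurableSingletonClass S]

lemma measure_span_corrected_gt_le {M : AMDP S A} {N : Seminorm ℝ (S → A → ℝ)} {K : ℝ} (hK : 1 ≤ K)
    (hN : ∀ Q, span Q ≤ N Q) (hN2 : ∀ Q, N Q ≤ 2 * span Q)
    (hc : ∀ Q Q', N (M.lazyBellman Q - M.lazyBellman Q') ≤
      (1 - 1 / (2 * contrConst K)) * N (Q - Q'))
    {QStar : S → A → ℝ} {g : ℝ} (hQ : M.IsOptimalQ g QStar) {η : Variant} {ε ξ : ℝ} (hε : 0 < ε)
    (hξ : 0 < ξ) (hξ1 : ξ < 1) {T : ℕ} (hT : 2 ≤ T) (hen : EnoughIterations S A iterConst K ε ξ T)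
    {Ω : Type w} [MeasurableSpace Ω] {μ : Measure Ω} [IsProbabilityMeasure μ]
    {X : ℕ → S → A → Ω → S} (hX : M.IsSampling η T X μ) :
    μ.real {ω | ¬ span (fun s a => corrected (M.iterate η (stepsize K T)
      (fun t s a => X t s a ω) T) s a - QStar s a) ≤ ε} ≤ ξ := by
  have hS : (1 : ℝ) ≤ Fintype.card S := by exact_mod_cast Fintype.card_pos
  have hA : (1 : ℝ) ≤ Fintype.card A := by exact_mod_cast Fintype.card_pos
  have hT' : (2 : ℝ) ≤ T := by exact_mod_cast hT
  have hκ := four_le_contrConst hK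
  have hlogT : 0 < Real.log T := Real.log_pos (by linarith)
  set L := Real.log (Fintype.card S * Fintype.card A * T / ξ) with hLdef
  have hL : Real.log 2 ≤ L := by
    refine Real.log_le_log two_pos ?_
    rw [le_div_iff₀ hξ]
    have : (1 : ℝ) ≤ Fintype.card S * Fintype.card A := one_le_mul_of_one_le_of_one_le hS hA
    nlinarith
  have hL0 : 0 < L := (Real.log_pos one_lt_two).trans_le hL
  have hbound := error_bound_le hK hε hT hL hen
  set u := √(contrConst K ^ 3 * Real.log T ^ 3 * L / T) with hu
  have hstep : stepsize K T = min 1 (contrConst K * Real.log T / T) := rfl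
  have h0 : 0 < stepsize K T := by
    rw [hstep]
    exact lt_min one_pos (by positivity)
  have h1 : stepsize K T ≤ 1 := by
    rw [hstep]
    exact min_le_left _ _
  have h2 : stepsize K T ≤ contrConst K * Real.log T / T := by
    rw [hstep]
    exact min_le_right _ _
  have hR : stepsize K T * T ≤ contrConst K * Real.log T := (le_div_iff₀ (by positivity)).1 h2
  have hu2 : stepsize K T * (contrConst K * Real.log T) ^ 2 *
      Real.log (2 * (Fintype.card S * Fintype.card A * T) / ξ) ≤ 2 * u ^ 2 := by
    rw [hu, Real.sq_sqrt (by positivity), mul_div_assoc, Real.log_mul two_ne_zero (by positivity)]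
    calc _ ≤ contrConst K * Real.log T / T * (contrConst K * Real.log T) ^ 2 * (L + L) := by
          gcongr
      _ = _ := by ring
  refine le_trans (measureReal_mono ?_) (measure_noise_gt_le hX h0 h1 hR (by positivity)
    (Real.sqrt_nonneg _) hξ (by omega) hu2)
  intro ω hω hgood
  exact hω ((span_corrected_error_le η (by linarith) hN hN2 hc hQ h0.le h1 _ hgood).trans hbound)

end Guarantee

end AMDP

theorem theorem2 :
    ∃ C₀ : ℝ, 0 < C₀ ∧ ∃ C₁ : ℝ, 0 < C₁ ∧
      ∀ (S : Type u) [Fintype S] [DecidableEq S] [Nonempty S]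
        [MeasurableSpace S] [MeasurableSingletonClass S]
        (A : Type v) [Fintype A] [Nonempty A]
        (M : AMDP S A) (sd : S), M.Reachable sd →
        -- well-posedness: `K < ∞`, gains exist and are state independent, `g*` and `Q*` exist
        M.maxHitTime sd ≠ ∞ ∧
        ∃ (g : (S → A) → ℝ) (gStar : ℝ),
          (∀ π, M.HasGain π (g π)) ∧
          IsGreatest (Set.range g) gStar ∧
          (∃ QStar, M.IsOptimalQ gStar QStar) ∧
          -- the guarantee for both variants of the algorithm
          (∀ QStar, M.IsOptimalQ gStar QStar →
            ∀ (η : AMDP.Variant) (ε ξ : ℝ), 0 < ε → 0 < ξ →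
            ∀ T : ℕ, 2 ≤ T → AMDP.EnoughIterations S A C₀ (M.hitConst sd) ε ξ T →
            ∀ (Ω : Type w) [MeasurableSpace Ω] (μ : Measure Ω) [IsProbabilityMeasure μ]
              (X : ℕ → S → A → Ω → S), M.IsSampling η T X μ →
              1 - ξ ≤ μ.real {ω |
                let QT := M.iterate η (AMDP.stepsize (M.hitConst sd) T)
                  (fun t s a => X t s a ω) T
                AMDP.span (fun s a => AMDP.corrected QT s a - QStar s a) ≤ ε ∧
                ∀ π, AMDP.IsGreedy (AMDP.corrected QT) π → gStar - g π ≤ ε}) ∧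
          -- the resulting total sample complexity
          (∀ ε ξ : ℝ, 0 < ε → ε ≤ 1 → 0 < ξ → ξ ≤ 1 →
            ∃ T : ℕ, 2 ≤ T ∧ AMDP.EnoughIterations S A C₀ (M.hitConst sd) ε ξ T ∧
              (AMDP.numSamples S A T : ℝ) ≤
                C₁ * (2 : ℝ) ^ (6 * M.hitConst sd) * (Fintype.card S * Fintype.card A) / ε ^ 2 *
                  (M.hitConst sd
                    + Real.log (Fintype.card S * Fintype.card A / (ε * ξ))) ^ 4) := by

  obtain ⟨C₁, hC₁, hiter⟩ := AMDP.exists_iterations AMDP.iterConst_pos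
  refine ⟨AMDP.iterConst, AMDP.iterConst_pos, C₁, hC₁, ?_⟩
  intro S _ _ _ _ _ A _ _ M sd hR
  obtain ⟨hfin, W, hW1, hWK, hW⟩ := M.exists_lyapunov hR
  have hK : 1 ≤ M.hitConst sd := (hW1 sd).trans (hWK sd)
  have hκ := AMDP.four_le_contrConst hK
  have hβ : 1 / (2 * AMDP.contrConst (M.hitConst sd)) ≤ 1 := by
    rw [div_le_one (by positivity)]
    linarith
  have hβ0 : 0 < 1 / (2 * AMDP.contrConst (M.hitConst sd)) := by positivity
  obtain ⟨N, hN, hN2, hc⟩ := M.exists_contracting_seminorm hW1 hWK hW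
  obtain ⟨Q, gStar, hQ⟩ := M.exists_lazyBellman_eq (by linarith) (by linarith) hN hN2 hc
  have hQs := M.isOptimalQ_corrected hQ
  choose h g hp using M.exists_isPoisson hW1 hWK hW
  refine ⟨hfin, g, gStar, fun π => M.hasGain_of_isPoisson (hp π), ⟨?_, ?_⟩, ⟨_, hQs⟩, ?_, ?_⟩
  · choose π hπ using AMDP.exists_eq_maxQ (AMDP.corrected Q)
    refine ⟨π, le_antisymm (M.gain_le (hp π) hQs) ?_⟩
    have hgr : AMDP.IsGreedy (AMDP.corrected Q) π := fun s a =>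
      (AMDP.le_maxQ _ s a).trans (hπ s).ge
    have := M.gain_gap_le (hp π) hQs hgr (ε := 0) (by
      simp only [sub_self]
      exact (AMDP.span_const 0).le)
    linarith
  · rintro _ ⟨π, rfl⟩
    exact M.gain_le (hp π) hQs
  · intro QStar hQStar η ε ξ hε hξ T hT hen Ω _ μ _ X hX
    rcases le_or_gt 1 ξ with hξ1 | hξ1
    · exact (sub_nonpos.2 hξ1).trans measureReal_nonneg
    have hbad := AMDP.measure_span_corrected_gt_le hK hN hN2 hc hQStar hε hξ hξ1 hT hen hX
    set G : Set Ω := {ω | AMDP.span (fun s a => AMDP.corrected (M.iterate η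
      (AMDP.stepsize (M.hitConst sd) T) (fun t s a => X t s a ω) T) s a - QStar s a) ≤ ε} with hG
    have h1 : 1 ≤ μ.real G + μ.real Gᶜ := by
      have := measureReal_union_le (μ := μ) G Gᶜ
      rwa [Set.union_compl_self, probReal_univ] at this
    have h2 : μ.real Gᶜ ≤ ξ := hbad
    refine (show 1 - ξ ≤ μ.real G by linarith).trans (measureReal_mono fun ω hω => ?_)
    exact ⟨hω, fun π hπ => M.gain_gap_le (hp π) hQStar hπ hω⟩
  · intro ε ξ hε hε1 hξ hξ1
    have hS : (1 : ℝ) ≤ Fintype.card S := by exact_mod_cast Fintype.card_pos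
    have hA : (1 : ℝ) ≤ Fintype.card A := by exact_mod_cast Fintype.card_pos
    obtain ⟨T, hT, h1, h2⟩ := hiter (M.hitConst sd) (Fintype.card S * Fintype.card A) ε ξ hK
      (one_le_mul_of_one_le_of_one_le hS hA) hε hε1 hξ hξ1
    refine ⟨T, hT, h1, le_trans (le_of_eq ?_) h2⟩
    rw [AMDP.numSamples, Finset.card_product, Nat.card_Icc, Finset.card_univ, Fintype.card_prod]
    push_cast
    ring
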